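/- Let $\alpha>0$, let $r\in\mathbb R$, put $\rho=r/\alpha$, and let $1\le p\le 6$ be an integer. Let $n=\lceil\alpha\rceil$, so $n-1<\alpha\le n$. Put $P_{p,r}(z)=\beta_0+\beta_1z+\dots+\beta_pz^p$ and $W_{p,r}(z)=P_{p,r}(z)^\alpha$ (principal power), with the following coefficients. - $p=1$: $\beta_0=1$, $\beta_1=-1$. - $p=2$: $\beta_0=\tfrac{3}{2}-\rho$, $\beta_1=-2+2\rho$, $\beta_2=\tfrac{1}{2}-\rho$. - $p=3$: $\beta_0=\tfrac{11}{6}-2\rho+\tfrac{1}{2}\rho^2$, $\beta_1=-3+5\rho-\tfrac{3}{2}\rho^2$, $\beta_2=\tfrac{3}{2}-4\rho+\tfrac{3}{2}\rho^2$, $\beta_3=-\tfrac{1}{3}+\rho-\tfrac{1}{2}\rho^2$. - $p=4$: $\beta_0=\tfrac{25}{12}-\tfrac{35}{12}\rho+\tfrac{5}{4}\rho^2-\tfrac{1}{6}\rho^3$, $\beta_1=-4+\tfrac{26}{3}\rho-\tfrac{9}{2}\rho^2+\tfrac{2}{3}\rho^3$, $\beta_2=3-\tfrac{19}{2}\rho+6\rho^2-\rho^3$,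 $\beta_3=-\tfrac{4}{3}+\tfrac{14}{3}\rho-\tfrac{7}{2}\rho^2+\tfrac{2}{3}\rho^3$, $\beta_4=\tfrac{1}{4}-\tfrac{11}{12}\rho+\tfrac{3}{4}\rho^2-\tfrac{1}{6}\rho^3$. - $p=5$: $\beta_0=\tfrac{137}{60}-\tfrac{15}{4}\rho+\tfrac{17}{8}\rho^2-\tfrac{1}{2}\rho^3+\tfrac{1}{24}\rho^4$, $\beta_1=-5+\tfrac{77}{6}\rho-\tfrac{71}{8}\rho^2+\tfrac{7}{3}\rho^3-\tfrac{5}{24}\rho^4$, $\beta_2=5-\tfrac{107}{6}\rho+\tfrac{59}{4}\rho^2-\tfrac{13}{3}\rho^3+\tfrac{5}{12}\rho^4$, $\beta_3=-\tfrac{10}{3}+13\rho-\tfrac{49}{4}\rho^2+4\rho^3-\tfrac{5}{12}\rho^4$, $\beta_4=\tfrac{5}{4}-\tfrac{61}{12}\rho+\tfrac{41}{8}\rho^2-\tfrac{11}{6}\rho^3+\tfrac{5}{24}\rho^4$, $\beta_5=-\tfrac{1}{5}+\tfrac{5}{6}\rho-\tfrac{7}{8}\rho^2+\tfrac{1}{3}\rho^3-\tfrac{1}{24}\rho^4$.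 - $p=6$: $\beta_0=\tfrac{49}{20}-\tfrac{203}{45}\rho+\tfrac{49}{16}\rho^2-\tfrac{35}{36}\rho^3+\tfrac{7}{48}\rho^4-\tfrac{1}{120}\rho^5$, $\beta_1=-6+\tfrac{87}{5}\rho-\tfrac{29}{2}\rho^2+\tfrac{31}{6}\rho^3-\tfrac{5}{6}\rho^4+\tfrac{1}{20}\rho^5$, $\beta_2=\tfrac{15}{2}-\tfrac{117}{4}\rho+\tfrac{461}{16}\rho^2-\tfrac{137}{12}\rho^3+\tfrac{95}{48}\rho^4-\tfrac{1}{8}\rho^5$, $\beta_3=-\tfrac{20}{3}+\tfrac{254}{9}\rho-31\rho^2+\tfrac{121}{9}\rho^3-\tfrac{5}{2}\rho^4+\tfrac{1}{6}\rho^5$, $\beta_4=\tfrac{15}{4}-\tfrac{33}{2}\rho+\tfrac{307}{16}\rho^2-\tfrac{107}{12}\rho^3+\tfrac{85}{48}\rho^4-\tfrac{1}{8}\rho^5$, $\beta_5=-\tfrac{6}{5}+\tfrac{27}{5}\rho-\tfrac{13}{2}\rho^2+\tfrac{19}{6}\rho^3-\tfrac{2}{3}\rho^4+\tfrac{1}{20}\rho^5$,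 $\beta_6=\tfrac{1}{6}-\tfrac{137}{180}\rho+\tfrac{15}{16}\rho^2-\tfrac{17}{36}\rho^3+\tfrac{5}{48}\rho^4-\tfrac{1}{120}\rho^5$. The left and right Grünwald–Letnikov derivatives are $${}_{-\infty}D_x^\alpha f(x)=\lim_{h\to0^+}\frac1{h^\alpha}\sum_{k\ge0}(-1)^k\binom\alpha k f(x-kh),\qquad {}_xD_\infty^\alpha f(x)=\lim_{h\to0^+}\frac1{h^\alpha}\sum_{k\ge0}(-1)^k\binom\alpha k f(x+kh),$$ and for a real sequence $(w_k)$ the Grünwald type operators with shift $r$ are $$\Delta^\alpha_{\mp h,r}f(x)=\frac1{h^\alpha}\sum_{k\ge0}w_k\,f(x\mp(k-r)h).$$ Then the following hold. 1. $W_{p,r}$ satisfies the order condition of order $p$ with shift $r$: $\;z^{-\alpha}\,W_{p,r}(e^{-z})\,e^{rz}=1+O(z^p)$ as $z\to0$, $z\in\mathbb C\setminus\{0\}$ (principal powers). 2. Suppose that $r=0$, or that $\alpha$ is an integer, or that $P_{p,r}$ has no zero in the open unit disc $|z|<1$. Then there is a real sequence $(w_k)$ with generating function $W_{p,r}$, that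 is, $W_{p,r}(z)=\sum_{k\ge0}w_kz^k$ for all $z$ near $0$, which approximates the left and right fractional derivatives of order $\alpha$ with order $p$ and shift $r$: for every $f\in C^{p+n+1}(\mathbb R)$, real valued, whose derivatives of orders $0,\dots,p+n+1$ are integrable on $\mathbb R$, both Grünwald–Letnikov derivatives of $f$ exist at every $x$, the series defining $\Delta^\alpha_{\mp h,r}f(x)$ converge absolutely for all $h>0$ and all $x$, and $$\Delta^\alpha_{-h,r}f(x)={}_{-\infty}D_x^\alpha f(x)+O(h^p),\qquad \Delta^\alpha_{+h,r}f(x)={}_xD_\infty^\alpha f(x)+O(h^p)\qquad(h\to0^+),$$ uniformly in $x\in\mathbb R$. 3. For $r=0$ these are Lubich's generators: $W_{p,0}(z)=\Bigl(\sum_{j=1}^p\tfrac1j(1-z)^j\Bigr)^\alpha$ for all $z\in\mathbb C$. -/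

import Mathlib

open Filter Topology MeasureTheory Asymptotics

namespace Grunwald

/-- The quotient whose limit as `h → 0⁺` is the left Grünwald-Letnikov derivative:
`h^{-α} ∑ₖ (-1)^k binom(α, k) f (x - k h)`. -/
noncomputable def leftGLQuotient (α : ℝ) (f : ℝ → ℝ) (x h : ℝ) : ℝ :=
  1 / h ^ α * ∑' k : ℕ, (-1 : ℝ) ^ k * Ring.choose α k * f (x - k * h)

/-- The quotient whose limit as `h → 0⁺` is the right Grünwald-Letnikov derivative. -/
noncomputable def rightGLQuotient (α : ℝ) (f : ℝ → ℝ) (x h : ℝ) : ℝ :=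
  1 / h ^ α * ∑' k : ℕ, (-1 : ℝ) ^ k * Ring.choose α k * f (x + k * h)

/-- `f` has left Grünwald-Letnikov derivative `d` of order `α` at `x`
(the series converge and the limit exists). -/
def HasLeftGLDerivAt (α : ℝ) (f : ℝ → ℝ) (d x : ℝ) : Prop :=
  (∀ᶠ h in 𝓝[>] (0 : ℝ),
    Summable fun k : ℕ => (-1 : ℝ) ^ k * Ring.choose α k * f (x - k * h)) ∧
  Tendsto (leftGLQuotient α f x) (𝓝[>] 0) (𝓝 d)

/-- `f` has right Grünwald-Letnikov derivative `d` of order `α` at `x`. -/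
def HasRightGLDerivAt (α : ℝ) (f : ℝ → ℝ) (d x : ℝ) : Prop :=
  (∀ᶠ h in 𝓝[>] (0 : ℝ),
    Summable fun k : ℕ => (-1 : ℝ) ^ k * Ring.choose α k * f (x + k * h)) ∧
  Tendsto (rightGLQuotient α f x) (𝓝[>] 0) (𝓝 d)

/-- The left Grünwald type operator with weights `w` and shift `r`. -/
noncomputable def leftOp (α r : ℝ) (w : ℕ → ℝ) (f : ℝ → ℝ) (h x : ℝ) : ℝ :=
  1 / h ^ α * ∑' k : ℕ, w k * f (x - ((k : ℝ) - r) * h)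

/-- The right Grünwald type operator with weights `w` and shift `r`. -/
noncomputable def rightOp (α r : ℝ) (w : ℕ → ℝ) (f : ℝ → ℝ) (h x : ℝ) : ℝ :=
  1 / h ^ α * ∑' k : ℕ, w k * f (x + ((k : ℝ) - r) * h)

/-- The weights `w` with shift `r` approximate the left and the right fractional derivative of
order `α` of `f` with order `p`: both derivatives exist on the whole line, the series defining the
operators converge, and the errors are `O(h^p)` as `h → 0⁺`, uniformly in `x`. -/
def ApproximatesWithOrder (α r : ℝ) (p : ℕ) (w : ℕ → ℝ) (f : ℝ → ℝ) : Prop :=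
  (∃ D : ℝ → ℝ, (∀ x, HasLeftGLDerivAt α f (D x) x) ∧
    (∀ h > 0, ∀ x, Summable fun k : ℕ => w k * f (x - ((k : ℝ) - r) * h)) ∧
    ∃ C : ℝ, ∀ᶠ h in 𝓝[>] (0 : ℝ), ∀ x, |leftOp α r w f h x - D x| ≤ C * h ^ p) ∧
  (∃ D : ℝ → ℝ, (∀ x, HasRightGLDerivAt α f (D x) x) ∧
    (∀ h > 0, ∀ x, Summable fun k : ℕ => w k * f (x + ((k : ℝ) - r) * h)) ∧
    ∃ C : ℝ, ∀ᶠ h in 𝓝[>] (0 : ℝ), ∀ x, |rightOp α r w f h x - D x| ≤ C * h ^ p)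

/-- `W` is the generating function of the real sequence `w`: `W z = ∑ₖ wₖ z^k` near `0`. -/
def IsGeneratingFunction (W : ℂ → ℂ) (w : ℕ → ℝ) : Prop :=
  ∀ᶠ z in 𝓝 (0 : ℂ), HasSum (fun k : ℕ => (w k : ℂ) * z ^ k) (W z)

/-- The functions to which the approximations are applied: with `n = ⌈α⌉`
(that is, `n - 1 < α ≤ n`), `f` is `C^{p+n+1}` and its derivatives of orders
`0, …, p + n + 1` are integrable on the line. -/
def SmoothIntegrable (α : ℝ) (p : ℕ) (f : ℝ → ℝ) : Prop :=
  ContDiff ℝ ((p + ⌈α⌉₊ + 1 : ℕ) : WithTop ℕ∞) f ∧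
  ∀ k ≤ p + ⌈α⌉₊ + 1, Integrable (iteratedDeriv k f)

/-- The table: `tableCoeff ρ p k` is the coefficient `β_k` of `W_{p,r}` for `ρ = r / α`. -/
noncomputable def tableCoeff (ρ : ℝ) : ℕ → ℕ → ℝ
  | 1, 0 => 1
  | 1, 1 => -1
  | 2, 0 => 3 / 2 - ρ
  | 2, 1 => -2 + 2 * ρ
  | 2, 2 => 1 / 2 - ρ
  | 3, 0 => 11 / 6 - 2 * ρ + 1 / 2 * ρ ^ 2
  | 3, 1 => -3 + 5 * ρ - 3 / 2 * ρ ^ 2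
  | 3, 2 => 3 / 2 - 4 * ρ + 3 / 2 * ρ ^ 2
  | 3, 3 => -1 / 3 + ρ - 1 / 2 * ρ ^ 2
  | 4, 0 => 25 / 12 - 35 / 12 * ρ + 5 / 4 * ρ ^ 2 - 1 / 6 * ρ ^ 3
  | 4, 1 => -4 + 26 / 3 * ρ - 9 / 2 * ρ ^ 2 + 2 / 3 * ρ ^ 3
  | 4, 2 => 3 - 19 / 2 * ρ + 6 * ρ ^ 2 - ρ ^ 3
  | 4, 3 => -4 / 3 + 14 / 3 * ρ - 7 / 2 * ρ ^ 2 + 2 / 3 * ρ ^ 3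
  | 4, 4 => 1 / 4 - 11 / 12 * ρ + 3 / 4 * ρ ^ 2 - 1 / 6 * ρ ^ 3
  | 5, 0 => 137 / 60 - 15 / 4 * ρ + 17 / 8 * ρ ^ 2 - 1 / 2 * ρ ^ 3 + 1 / 24 * ρ ^ 4
  | 5, 1 => -5 + 77 / 6 * ρ - 71 / 8 * ρ ^ 2 + 7 / 3 * ρ ^ 3 - 5 / 24 * ρ ^ 4
  | 5, 2 => 5 - 107 / 6 * ρ + 59 / 4 * ρ ^ 2 - 13 / 3 * ρ ^ 3 + 5 / 12 * ρ ^ 4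
  | 5, 3 => -10 / 3 + 13 * ρ - 49 / 4 * ρ ^ 2 + 4 * ρ ^ 3 - 5 / 12 * ρ ^ 4
  | 5, 4 => 5 / 4 - 61 / 12 * ρ + 41 / 8 * ρ ^ 2 - 11 / 6 * ρ ^ 3 + 5 / 24 * ρ ^ 4
  | 5, 5 => -1 / 5 + 5 / 6 * ρ - 7 / 8 * ρ ^ 2 + 1 / 3 * ρ ^ 3 - 1 / 24 * ρ ^ 4
  | 6, 0 => 49 / 20 - 203 / 45 * ρ + 49 / 16 * ρ ^ 2 - 35 / 36 * ρ ^ 3 + 7 / 48 * ρ ^ 4 - 1 / 120 * ρ ^ 5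
  | 6, 1 => -6 + 87 / 5 * ρ - 29 / 2 * ρ ^ 2 + 31 / 6 * ρ ^ 3 - 5 / 6 * ρ ^ 4 + 1 / 20 * ρ ^ 5
  | 6, 2 => 15 / 2 - 117 / 4 * ρ + 461 / 16 * ρ ^ 2 - 137 / 12 * ρ ^ 3 + 95 / 48 * ρ ^ 4 - 1 / 8 * ρ ^ 5
  | 6, 3 => -20 / 3 + 254 / 9 * ρ - 31 * ρ ^ 2 + 121 / 9 * ρ ^ 3 - 5 / 2 * ρ ^ 4 + 1 / 6 * ρ ^ 5
  | 6, 4 => 15 / 4 - 33 / 2 * ρ + 307 / 16 * ρ ^ 2 - 107 / 12 * ρ ^ 3 + 85 / 48 * ρ ^ 4 - 1 / 8 * ρ ^ 5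
  | 6, 5 => -6 / 5 + 27 / 5 * ρ - 13 / 2 * ρ ^ 2 + 19 / 6 * ρ ^ 3 - 2 / 3 * ρ ^ 4 + 1 / 20 * ρ ^ 5
  | 6, 6 => 1 / 6 - 137 / 180 * ρ + 15 / 16 * ρ ^ 2 - 17 / 36 * ρ ^ 3 + 5 / 48 * ρ ^ 4 - 1 / 120 * ρ ^ 5
  | _, _ => 0

/-- `β_0 + β_1 z + ⋯ + β_p z^p` with the coefficients of the table at `ρ = r / α`. -/
noncomputable def tablePoly (p : ℕ) (ρ : ℝ) (z : ℂ) : ℂ :=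
  ∑ k ∈ Finset.range (p + 1), (tableCoeff ρ p k : ℂ) * z ^ k

/-- The generator `W_{p,r}(z) = (β_0 + β_1 z + ⋯ + β_p z^p)^α` (principal power). -/
noncomputable def generator (p : ℕ) (α r : ℝ) (z : ℂ) : ℂ :=
  tablePoly p (r / α) z ^ (α : ℂ)

/-- Lubich's generator `L_p(z) = (∑_{j=1}^p (1 - z)^j / j)^α`. -/
noncomputable def lubich (p : ℕ) (α : ℝ) (z : ℂ) : ℂ :=
  (∑ j ∈ Finset.Icc 1 p, 1 / (j : ℂ) * (1 - z) ^ j) ^ (α : ℂ)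

end Grunwald

/-! ### The order condition and the generators without shift. -/

namespace Grunwald

open ComplexConjugate

/-! The table solves the moment equations `∑ β_k k^j = -j ρ^(j-1)` for `0 ≤ j ≤ p`, which say that
`P(e^{-z}) = z e^{-ρz} + O(z^{p+1})`. Hence `P(e^{-z}) e^{ρz} / z = 1 + O(z^p)`, and since `r = αρ`,
raising to the power `α` gives the order condition, once the principal power of `P(e^{-z})` is known
to split off `z^α` (`eventually_cpow_eq_mul_cpow`).

For the approximation, `P(1) = 0` and `P'(1) = -1`, so `P(u) = (1 - u) R(u)` with `R(1) = 1`. If `P`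
has no zero in the open unit disc, `P^α` is a constant times a product of powers `(1 - u/ζ)^α` with
`|ζ| ≥ 1`, and each has absolutely summable binomial coefficients because `α > 0`
(`exists_summable_weights`). The operator is then a Fourier multiplier. Its symbol differs from
`(iy)^α` by `O(|y|^{α+p})` on the whole line: near `0` by the order condition, elsewhere because the
symbol is bounded (`exists_norm_symbol_sub_le`). The transform of `f` decays like `|t|^{-(p+n+1)}`,
so the scaled error integrates to `O(h^p)` as soon as `n > α`. The Grünwald–Letnikov quotient is the
operator with `p = 1` and `r = 0`; the same estimate shows that it converges, and to the same limit.

For integral `α` one has `n = α` and the decay just fails to suffice. There `W` is a polynomial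
wherever its zeros lie, and Taylor expansion replaces the Fourier transform
(`exists_leftOp_sub_iteratedDeriv_le`). For `r = 0` a Schur–Cohn certificate excludes zeros in the
open disc (`tablePoly_zero_ne_zero`). -/

theorem sum_tableCoeff_mul_pow (ρ : ℝ) {p j : ℕ} (hp1 : 1 ≤ p) (hp6 : p ≤ 6) (hj : j ≤ p) :
    ∑ k ∈ Finset.range (p + 1), tableCoeff ρ p k * (k : ℝ) ^ j = -(j * ρ ^ (j - 1)) := by
  interval_cases p
  all_goals
    simp only [Finset.sum_range_succ, Finset.sum_range_zero, tableCoeff]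
    interval_cases j <;> push_cast <;> ring

theorem tablePoly_conj (p : ℕ) (ρ : ℝ) (z : ℂ) :
    tablePoly p ρ (conj z) = conj (tablePoly p ρ z) := by
  simp [tablePoly, map_sum]

theorem exp_sub_sum_isBigO (c : ℂ) (n : ℕ) :
    (fun z : ℂ => Complex.exp (c * z) - ∑ m ∈ Finset.range n, (c * z) ^ m / (m.factorial : ℂ))
      =O[𝓝 0] fun z => z ^ n := by
  refine IsBigO.of_bound (‖c‖ ^ n * Real.exp (‖c‖ * 1)) ?_
  filter_upwards [Metric.closedBall_mem_nhds (0 : ℂ) one_pos] with z hz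
  have hz1 : ‖z‖ ≤ 1 := by simpa using hz
  refine (Complex.norm_exp_sub_sum_le_norm_mul_exp (c * z) n).trans ?_
  rw [norm_mul, mul_pow, norm_pow]
  have : Real.exp (‖c‖ * ‖z‖) ≤ Real.exp (‖c‖ * 1) := by gcongr
  calc _ ≤ ‖c‖ ^ n * ‖z‖ ^ n * Real.exp (‖c‖ * 1) := by gcongr
    _ = _ := by ring

theorem sum_tableCoeff_mul_exp_taylor (ρ : ℝ) {p : ℕ} (hp1 : 1 ≤ p) (hp6 : p ≤ 6) (z : ℂ) :
    ∑ k ∈ Finset.range (p + 1), (tableCoeff ρ p k : ℂ) *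
      ∑ m ∈ Finset.range (p + 1), (-(k : ℂ) * z) ^ m / (m.factorial : ℂ) =
    z * ∑ m ∈ Finset.range p, (-(ρ : ℂ) * z) ^ m / (m.factorial : ℂ) := by
  have hmom : ∀ m ∈ Finset.range (p + 1),
      ∑ k ∈ Finset.range (p + 1), (tableCoeff ρ p k : ℂ) * ((-(k : ℂ) * z) ^ m / (m.factorial : ℂ))
        = (-z) ^ m / (m.factorial : ℂ) * (-(m * (ρ : ℂ) ^ (m - 1))) := by
    intro m hm
    have h := sum_tableCoeff_mul_pow ρ hp1 hp6 (Nat.lt_succ_iff.mp (Finset.mem_range.mp hm))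
    have h' := congrArg (fun t : ℝ => (t : ℂ)) h
    push_cast at h'
    rw [← h', Finset.mul_sum]
    refine Finset.sum_congr rfl fun k _ => ?_
    rw [show -(k : ℂ) * z = -z * k by ring, mul_pow]
    ring
  simp_rw [Finset.mul_sum]
  rw [Finset.sum_comm, Finset.sum_congr rfl hmom, Finset.sum_range_succ']
  -- The term `m = 0` carries the factor `m`, so the truncated exponent `m - 1` is harmless there.
  -- The shift `m ↦ m + 1` then produces the factor `z` and the shorter sum.
  rw [Nat.cast_zero, zero_mul, neg_zero, mul_zero, add_zero]
  refine Finset.sum_congr rfl fun m _ => ?_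
  have h1 : (m.factorial : ℂ) ≠ 0 := by exact_mod_cast m.factorial_ne_zero
  have h2 : (m : ℂ) + 1 ≠ 0 := by exact_mod_cast m.succ_ne_zero
  rw [Nat.factorial_succ, show -(ρ : ℂ) * z = -z * ρ by ring, mul_pow, pow_succ]
  push_cast
  field_simp

theorem tablePoly_exp_sub_isBigO (ρ : ℝ) {p : ℕ} (hp1 : 1 ≤ p) (hp6 : p ≤ 6) :
    (fun z : ℂ => tablePoly p ρ (Complex.exp (-z)) - z * Complex.exp (-(ρ : ℂ) * z))
      =O[𝓝 0] fun z => z ^ (p + 1) := by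
  have h1 : (fun z : ℂ => ∑ k ∈ Finset.range (p + 1), (tableCoeff ρ p k : ℂ) *
      (Complex.exp (-(k : ℂ) * z) - ∑ m ∈ Finset.range (p + 1),
        (-(k : ℂ) * z) ^ m / (m.factorial : ℂ))) =O[𝓝 0] fun z => z ^ (p + 1) :=
    IsBigO.fun_sum fun k _ => (exp_sub_sum_isBigO (-(k : ℂ)) (p + 1)).const_mul_left _
  have h2 : (fun z : ℂ => z * (Complex.exp (-(ρ : ℂ) * z) - ∑ m ∈ Finset.range p,
        (-(ρ : ℂ) * z) ^ m / (m.factorial : ℂ))) =O[𝓝 0] fun z => z ^ (p + 1) := by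
    have := (isBigO_refl (fun z : ℂ => z) (𝓝 0)).mul (exp_sub_sum_isBigO (-(ρ : ℂ)) p)
    refine this.congr_right fun z => ?_
    ring
  refine (h1.sub h2).congr_left fun z => ?_
  have h3 := sum_tableCoeff_mul_exp_taylor ρ hp1 hp6 z
  simp only [mul_sub, Finset.sum_sub_distrib] at h3 ⊢
  rw [h3]
  have h4 : tablePoly p ρ (Complex.exp (-z)) =
      ∑ k ∈ Finset.range (p + 1), (tableCoeff ρ p k : ℂ) * Complex.exp (-(k : ℂ) * z) := by
    refine Finset.sum_congr rfl fun k _ => ?_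
    rw [← Complex.exp_nat_mul]
    congr 2
    ring
  rw [h4]
  ring

theorem tablePoly_one (ρ : ℝ) {p : ℕ} (hp1 : 1 ≤ p) (hp6 : p ≤ 6) : tablePoly p ρ 1 = 0 := by
  have h := sum_tableCoeff_mul_pow ρ hp1 hp6 (Nat.zero_le p)
  have h' := congrArg (fun t : ℝ => (t : ℂ)) h
  push_cast at h'
  simpa [tablePoly] using h'

theorem hasStrictDerivAt_tablePoly (p : ℕ) (ρ : ℝ) (z : ℂ) :
    HasStrictDerivAt (tablePoly p ρ)
      (∑ k ∈ Finset.range (p + 1), (tableCoeff ρ p k : ℂ) * (k * z ^ (k - 1))) z := by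
  unfold tablePoly
  exact HasStrictDerivAt.fun_sum fun k _ => (hasStrictDerivAt_pow k z).const_mul _

theorem hasStrictDerivAt_tablePoly_one (ρ : ℝ) {p : ℕ} (hp1 : 1 ≤ p) (hp6 : p ≤ 6) :
    HasStrictDerivAt (tablePoly p ρ) (-1) 1 := by
  have h := sum_tableCoeff_mul_pow ρ hp1 hp6 hp1
  have h' := congrArg (fun t : ℝ => (t : ℂ)) h
  push_cast at h'
  convert hasStrictDerivAt_tablePoly p ρ 1 using 1
  simpa using h'.symm

theorem hasStrictDerivAt_tablePoly_exp_neg (ρ : ℝ) {p : ℕ} (hp1 : 1 ≤ p) (hp6 : p ≤ 6) :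
    HasStrictDerivAt (fun z => tablePoly p ρ (Complex.exp (-z))) 1 0 := by
  have h2 : HasStrictDerivAt (fun z : ℂ => Complex.exp (-z)) (-1) 0 := by
    simpa using (hasStrictDerivAt_neg (0 : ℂ)).cexp
  have h1 : HasStrictDerivAt (tablePoly p ρ) (-1) (Complex.exp (-0)) := by
    simpa using hasStrictDerivAt_tablePoly_one ρ hp1 hp6
  have h := h1.comp (0 : ℂ) h2
  rwa [neg_mul_neg, one_mul] at h

/-- A function with real coefficients and derivative `1` at the zero `0` maps the upper half plane
to itself near `0`, so that its principal powers split as those of `z`. -/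
theorem eventually_cpow_eq_mul_cpow {F : ℂ → ℂ} (hF0 : F 0 = 0) (hF : HasStrictDerivAt F 1 0)
    (hconj : ∀ z, F (conj z) = conj (F z)) (a : ℂ) :
    ∀ᶠ z in 𝓝[≠] (0 : ℂ), 0 < (F z / z).re ∧ F z ^ a = z ^ a * (F z / z) ^ a := by
  have hlin := hF.isLittleO.bound (show (0 : ℝ) < 1 / 2 by norm_num)
  -- Strict differentiability is applied to two pairs of points: `(z, Re z)` controls the sign of
  -- `Im F(z)`, and `(z, 0)` keeps `F(z) / z` close to `1`.
  have hre : Tendsto (fun z : ℂ => (z, ((z.re : ℝ) : ℂ))) (𝓝[≠] 0) (𝓝 ((0 : ℂ), (0 : ℂ))) := by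
    have : Continuous fun z : ℂ => (z, ((z.re : ℝ) : ℂ)) := by fun_prop
    exact (this.tendsto' 0 _ (by simp)).mono_left nhdsWithin_le_nhds
  have h0 : Tendsto (fun z : ℂ => (z, (0 : ℂ))) (𝓝[≠] 0) (𝓝 ((0 : ℂ), (0 : ℂ))) := by
    have : Continuous fun z : ℂ => (z, (0 : ℂ)) := by fun_prop
    exact (this.tendsto' 0 _ (by simp)).mono_left nhdsWithin_le_nhds
  filter_upwards [hre.eventually hlin, h0.eventually hlin, self_mem_nhdsWithin] with z h1 h2 hz
  have hz : z ≠ 0 := hz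
  simp only [hF0, sub_zero, ContinuousLinearMap.toSpanSingleton_apply, smul_eq_mul, mul_one]
    at h1 h2
  set q := F z / z with hq
  have hFq : F z = z * q := by rw [hq]; field_simp
  have hq1 : ‖q - 1‖ ≤ 1 / 2 := by
    have : ‖z‖ * ‖q - 1‖ ≤ ‖z‖ * (1 / 2) := by
      rw [← norm_mul, show z * (q - 1) = F z - z by rw [hFq]; ring]
      linarith
    exact le_of_mul_le_mul_left this (norm_pos_iff.mpr hz)
  have hqre : 0 < q.re := by
    have := (Complex.abs_re_le_norm (q - 1)).trans hq1
    rw [abs_le] at this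
    simp at this
    linarith
  have hq0 : q ≠ 0 := fun h => by simp [h] at hqre
  have hqarg : |q.arg| < Real.pi / 2 := Complex.abs_arg_lt_pi_div_two_iff.mpr (Or.inl hqre)
  rw [abs_lt] at hqarg
  refine ⟨hqre, ?_⟩
  have hreal : (F (z.re : ℂ)).im = 0 := by
    have := hconj (z.re : ℂ)
    rw [Complex.conj_ofReal] at this
    exact Complex.conj_eq_iff_im.mp this.symm
  have him : |(F z).im - z.im| ≤ 1 / 2 * |z.im| := by
    have e : z - (z.re : ℂ) = z.im * Complex.I := by
      apply Complex.ext <;> simp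
    have := (Complex.abs_im_le_norm _).trans h1
    rw [e] at this
    simpa [hreal] using this
  -- The sine of the sum of the arguments has the sign of `Im F(z)`, which is that of `Im z`, so the
  -- sum cannot cross the cut. On the real axis `q` is real and positive and adds no argument.
  have harg : z.arg + q.arg ∈ Set.Ioc (-Real.pi) Real.pi := by
    have hsin : (F z).im = ‖z‖ * ‖q‖ * Real.sin (z.arg + q.arg) := by
      rw [hFq, Complex.mul_im, Real.sin_add]
      linear_combination -(‖q‖ * Real.sin q.arg) * Complex.norm_mul_cos_arg z -
        z.re * Complex.norm_mul_sin_arg q - (‖q‖ * Real.cos q.arg) * Complex.norm_mul_sin_arg z -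
        z.im * Complex.norm_mul_cos_arg q
    have hn : 0 ≤ ‖z‖ * ‖q‖ := by positivity
    have hz2 := Complex.arg_le_pi z
    have hz3 := Complex.neg_pi_lt_arg z
    rcases lt_trichotomy z.im 0 with hneg | hzero | hpos
    · have hz4 : z.arg < 0 := Complex.arg_neg_iff.mpr hneg
      rw [abs_of_neg hneg, abs_le] at him
      refine ⟨?_, by linarith⟩
      by_contra! hcon
      have : 0 ≤ Real.sin (z.arg + q.arg) := by
        rw [← Real.sin_add_two_pi]
        exact Real.sin_nonneg_of_nonneg_of_le_pi (by linarith) (by linarith)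
      have := mul_nonneg hn this
      linarith
    · have hqim : q.im = 0 := by
        have e : z = (z.re : ℂ) := by apply Complex.ext <;> simp [hzero]
        rw [hq, e, Complex.div_ofReal_im, hreal, zero_div]
      have : q.arg = 0 := Complex.arg_eq_zero_iff.mpr ⟨hqre.le, hqim⟩
      rw [this, add_zero]
      exact ⟨hz3, hz2⟩
    · have hz4 : 0 ≤ z.arg := Complex.arg_nonneg_iff.mpr hpos.le
      rw [abs_of_pos hpos, abs_le] at him
      refine ⟨by linarith, ?_⟩
      by_contra! hcon
      have : Real.sin (z.arg + q.arg) ≤ 0 := by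
        rw [← Real.sin_sub_two_pi]
        exact Real.sin_nonpos_of_nonpos_of_neg_pi_le (by linarith) (by linarith)
      have := mul_nonpos_of_nonneg_of_nonpos hn this
      linarith
  rw [hFq, Complex.cpow_def_of_ne_zero (mul_ne_zero hz hq0), Complex.cpow_def_of_ne_zero hz,
    Complex.cpow_def_of_ne_zero hq0, Complex.log_mul hz hq0 harg, add_mul, Complex.exp_add]

theorem generator_isBigO (α r : ℝ) (hα : 0 < α) {p : ℕ} (hp1 : 1 ≤ p) (hp6 : p ≤ 6) :
    (fun z : ℂ => 1 / z ^ (α : ℂ) * generator p α r (Complex.exp (-z)) * Complex.exp ((r : ℂ) * z)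
      - 1) =O[𝓝[≠] 0] fun z : ℂ => z ^ p := by
  set ρ := r / α with hρ
  have hr : (r : ℂ) = α * ρ := by
    rw [hρ]; push_cast; field_simp [show (α : ℂ) ≠ 0 by exact_mod_cast hα.ne']
  set F : ℂ → ℂ := fun z => tablePoly p ρ (Complex.exp (-z)) with hF
  have hsplit := eventually_cpow_eq_mul_cpow (F := F) (by simp [hF, tablePoly_one ρ hp1 hp6])
    (hasStrictDerivAt_tablePoly_exp_neg ρ hp1 hp6)
    (fun z => by simp only [hF]; rw [← tablePoly_conj, ← Complex.exp_conj, map_neg]) α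
  set v : ℂ → ℂ := fun z => F z / z * Complex.exp (ρ * z) with hv
  have hv1 : (fun z => v z - 1) =O[𝓝[≠] 0] fun z : ℂ => z ^ p := by
    have h1 := ((tablePoly_exp_sub_isBigO ρ hp1 hp6).mono (nhdsWithin_le_nhds (s := {0}ᶜ)))
    have h2 := (isBigO_refl (fun z : ℂ => z⁻¹) (𝓝[≠] 0)).mul h1
    have h3 : (fun z : ℂ => Complex.exp (ρ * z)) =O[𝓝[≠] 0] fun _ => (1 : ℂ) := by
      have : Continuous fun z : ℂ => Complex.exp (ρ * z) := by fun_prop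
      exact ((this.tendsto 0).mono_left nhdsWithin_le_nhds).isBigO_one ℂ
    refine (h2.mul h3).congr' ?_ ?_
    · filter_upwards [self_mem_nhdsWithin] with z hz
      have hz : z ≠ 0 := hz
      have he : Complex.exp (-(ρ : ℂ) * z) * Complex.exp (ρ * z) = 1 := by
        rw [← Complex.exp_add]; simp
      simp only [hv, hF]
      rw [mul_assoc, sub_mul, mul_assoc z, he]
      field_simp
    · filter_upwards [self_mem_nhdsWithin] with z hz
      have hz : z ≠ 0 := hz
      rw [pow_succ]; field_simp
  have hvt : Tendsto v (𝓝[≠] 0) (𝓝 1) := by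
    have h0 : Tendsto (fun z : ℂ => z ^ p) (𝓝[≠] 0) (𝓝 0) := by
      have : Continuous fun z : ℂ => z ^ p := by fun_prop
      exact (this.tendsto' 0 _ (zero_pow (by omega))).mono_left nhdsWithin_le_nhds
    have := (hv1.trans_tendsto h0).add_const 1
    simpa using this
  have hpow : (fun z => v z ^ (α : ℂ) - 1) =O[𝓝[≠] 0] fun z : ℂ => z ^ p := by
    -- Differentiability of `u ^ α` at `1` gives `v ^ α - 1 = O(v - 1)`.
    have hd : HasDerivAt (fun u : ℂ => u ^ (α : ℂ)) _ 1 :=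
      (hasDerivAt_id (1 : ℂ)).cpow_const (c := (α : ℂ)) Complex.one_mem_slitPlane
    have := hd.isBigO_sub.comp_tendsto hvt
    simp only [Function.comp_def, Complex.one_cpow] at this
    exact this.trans hv1
  refine hpow.congr' ?_ EventuallyEq.rfl
  have hexp : ∀ᶠ z in 𝓝[≠] (0 : ℂ), ‖(ρ : ℂ) * z‖ < Real.pi / 2 := by
    have : Continuous fun z : ℂ => ‖(ρ : ℂ) * z‖ := by fun_prop
    exact ((this.tendsto' 0 0 (by simp)).mono_left nhdsWithin_le_nhds).eventually_lt_const
      (by positivity)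
  filter_upwards [hsplit, self_mem_nhdsWithin, hexp] with z hz hz0 hz2
  have hz0 : z ≠ 0 := hz0
  obtain ⟨hqre, hz⟩ := hz
  have hq0 : F z / z ≠ 0 := fun h => by simp [h] at hqre
  have hza : z ^ (α : ℂ) ≠ 0 := by simp [Complex.cpow_eq_zero_iff, hz0]
  -- Both imaginary parts are below `π / 2` in absolute value, so the sum is the principal
  -- logarithm.
  have hlog : Complex.log (v z) = Complex.log (F z / z) + ρ * z := by
    have e : v z = Complex.exp (Complex.log (F z / z) + ρ * z) := by
      rw [Complex.exp_add, Complex.exp_log hq0]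
    have hqarg := Complex.abs_arg_lt_pi_div_two_iff.mpr (Or.inl hqre)
    rw [abs_lt] at hqarg
    have him := (Complex.abs_im_le_norm _).trans_lt hz2
    rw [abs_lt] at him
    rw [e, Complex.log_exp] <;> rw [Complex.add_im, Complex.log_im] <;> linarith
  have hv0 : v z ≠ 0 := mul_ne_zero hq0 (Complex.exp_ne_zero _)
  have hg : generator p α r (Complex.exp (-z)) = F z ^ (α : ℂ) := rfl
  rw [hg, hz, Complex.cpow_def_of_ne_zero hv0, hlog, add_mul, Complex.exp_add, hr,
    ← Complex.cpow_def_of_ne_zero hq0]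
  field_simp

theorem generator_zero_shift (α : ℝ) {p : ℕ} (hp1 : 1 ≤ p) (hp6 : p ≤ 6) (z : ℂ) :
    generator p α 0 z = lubich p α z := by
  unfold generator lubich
  congr 1
  interval_cases p <;>
    simp only [tablePoly, zero_div, Finset.sum_range_succ, Finset.sum_range_zero, tableCoeff,
      Finset.sum_Icc_succ_top, Finset.Icc_self, Finset.sum_singleton,
      Nat.reduceAdd, Nat.one_le_ofNat] <;>
    push_cast <;> ring

end Grunwald

/-! ### Absolutely convergent power series for `P^α` on the closed disc. -/

namespace Grunwald

open ComplexConjugate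

theorem succ_mul_choose_succ (α : ℝ) (k : ℕ) :
    ((k : ℝ) + 1) * Ring.choose α (k + 1) = (α - k) * Ring.choose α k := by
  rw [Ring.choose_eq_smul, Ring.choose_eq_smul, descPochhammer_succ_right, Polynomial.smeval_mul,
    Nat.factorial_succ]
  have h1 : (k.factorial : ℝ) ≠ 0 := by exact_mod_cast k.factorial_ne_zero
  have h2 : (k : ℝ) + 1 ≠ 0 := by exact_mod_cast k.succ_ne_zero
  simp [Polynomial.smeval_sub, Polynomial.smeval_natCast]
  field_simp

/-- The binomial coefficients of a positive real number are absolutely summable. -/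
theorem summable_abs_choose {α : ℝ} (hα : 0 < α) :
    Summable fun k : ℕ => |Ring.choose α k| := by
  obtain ⟨K, hK⟩ := exists_nat_ge α
  -- From index `K ≥ α` on, the recurrence has a factor of constant sign, so `α |binom(α, k)|` is a
  -- difference of consecutive terms `k |binom(α, k)|` and the partial sums telescope.
  have hstep : ∀ k : ℕ, α * |Ring.choose α (k + K)| =
      ((k + K : ℕ) : ℝ) * |Ring.choose α (k + K)| -
        ((k + 1 + K : ℕ) : ℝ) * |Ring.choose α (k + 1 + K)| := by
    intro k
    have h := congrArg abs (succ_mul_choose_succ α (k + K))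
    have hk : α - ((k + K : ℕ) : ℝ) ≤ 0 := by push_cast; linarith [(Nat.cast_nonneg k : (0 : ℝ) ≤ k)]
    rw [abs_mul, abs_mul, abs_of_nonpos hk, abs_of_nonneg (by positivity)] at h
    rw [show k + 1 + K = k + K + 1 by ring, Nat.cast_succ, h]
    ring
  refine (summable_nat_add_iff K).mp (summable_of_sum_range_le (c := K * |Ring.choose α K| / α)
    (fun _ => abs_nonneg _) fun n => ?_)
  rw [le_div_iff₀ hα, mul_comm, Finset.mul_sum, Finset.sum_congr rfl fun k _ => hstep k,
    Finset.sum_range_sub' (fun k : ℕ => ((k + K : ℕ) : ℝ) * |Ring.choose α (k + K)|)]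
  simp only [zero_add]
  have : 0 ≤ ((n + K : ℕ) : ℝ) * |Ring.choose α (n + K)| := by positivity
  linarith

/-- `S` is the sum of an absolutely convergent power series on the closed unit disc. -/
def IsAbsPowerSeries (S : ℂ → ℂ) : Prop :=
  ∃ a : ℕ → ℂ, Summable (fun k => ‖a k‖) ∧
    ∀ u, ‖u‖ ≤ 1 → HasSum (fun k => a k * u ^ k) (S u)

theorem summable_norm_mul_pow {a : ℕ → ℂ} (ha : Summable fun k => ‖a k‖) {u : ℂ} (hu : ‖u‖ ≤ 1) :
    Summable fun k => ‖a k * u ^ k‖ := by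
  refine ha.of_nonneg_of_le (fun _ => norm_nonneg _) fun k => ?_
  rw [norm_mul, norm_pow]
  exact mul_le_of_le_one_right (norm_nonneg _) (pow_le_one₀ (norm_nonneg _) hu)

theorem IsAbsPowerSeries.mul {S T : ℂ → ℂ} (hS : IsAbsPowerSeries S) (hT : IsAbsPowerSeries T) :
    IsAbsPowerSeries fun u => S u * T u := by
  obtain ⟨a, ha, hSa⟩ := hS
  obtain ⟨b, hb, hTb⟩ := hT
  refine ⟨fun n => ∑ kl ∈ Finset.HasAntidiagonal.antidiagonal n, a kl.1 * b kl.2,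
    summable_norm_sum_mul_antidiagonal_of_summable_norm ha hb, fun u hu => ?_⟩
  have h1 := summable_norm_mul_pow ha hu
  have h2 := summable_norm_mul_pow hb hu
  have h3 := summable_norm_sum_mul_antidiagonal_of_summable_norm h1 h2
  have h4 := tsum_mul_tsum_eq_tsum_sum_antidiagonal_of_summable_norm h1 h2
  rw [(hSa u hu).tsum_eq, (hTb u hu).tsum_eq] at h4
  simp only
  rw [h4]
  have hterm : ∀ n, (∑ kl ∈ Finset.HasAntidiagonal.antidiagonal n, a kl.1 * b kl.2) * u ^ n =
      ∑ kl ∈ Finset.HasAntidiagonal.antidiagonal n, a kl.1 * u ^ kl.1 * (b kl.2 * u ^ kl.2) := ?_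
  · simpa only [hterm] using h3.of_norm.hasSum
  intro n
  rw [Finset.sum_mul]
  refine Finset.sum_congr rfl fun kl hkl => ?_
  rw [← Finset.HasAntidiagonal.mem_antidiagonal.mp hkl, pow_add]
  ring

theorem isAbsPowerSeries_const (c : ℂ) : IsAbsPowerSeries fun _ => c := by
  refine ⟨fun k => if k = 0 then c else 0, ?_, fun u _ => ?_⟩
  · exact summable_of_ne_finset_zero (s := {0}) fun k hk => by simp at hk; simp [hk]
  · convert hasSum_single (f := fun k : ℕ => (if k = 0 then c else 0) * u ^ k) 0 ?_ using 1
    · simp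
    · intro k hk; simp [hk]

theorem one_sub_re_nonneg {v : ℂ} (hv : ‖v‖ ≤ 1) : 0 ≤ (1 - v).re := by
  have := (Complex.re_le_norm v).trans hv
  simpa using this

theorem summable_norm_choose_mul {α : ℝ} (hα : 0 < α) :
    Summable fun k : ℕ => ‖(((-1) ^ k * Ring.choose α k : ℝ) : ℂ)‖ := by
  simpa [abs_mul] using summable_abs_choose hα

/-- The binomial series of `(1 - v)^α` for `α > 0` on the closed unit disc. -/
theorem hasSum_one_sub_cpow {α : ℝ} (hα : 0 < α) {v : ℂ} (hv : ‖v‖ ≤ 1) :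
    HasSum (fun k : ℕ => (((-1) ^ k * Ring.choose α k : ℝ) : ℂ) * v ^ k) ((1 - v) ^ (α : ℂ)) := by
  set a : ℕ → ℂ := fun k => (((-1) ^ k * Ring.choose α k : ℝ) : ℂ) with ha
  have hsum := summable_norm_choose_mul hα
  have hcont1 : ContinuousOn (fun u : ℂ => ∑' k, a k * u ^ k) (Metric.closedBall 0 1) := by
    refine continuousOn_tsum (fun k => by fun_prop) hsum fun k u hu => ?_
    rw [norm_mul, norm_pow]
    exact mul_le_of_le_one_right (norm_nonneg _) (pow_le_one₀ (norm_nonneg _) (by simpa using hu))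
  have hcont2 : ContinuousOn (fun u : ℂ => (1 - u) ^ (α : ℂ)) (Metric.closedBall 0 1) := by
    intro u hu
    have h := Complex.continuousAt_cpow_const_of_re_pos (z := 1 - u) (w := α)
      (Or.inl (one_sub_re_nonneg (by simpa using hu))) (by simpa using hα)
    exact (ContinuousAt.comp (f := fun u : ℂ => 1 - u) h (by fun_prop)).continuousWithinAt
  -- The identity is classical on the open disc. Both sides are continuous up to the boundary, at `u
  -- = 1` because `α > 0`, so it extends by density.
  have heq : Set.EqOn (fun u : ℂ => ∑' k, a k * u ^ k) (fun u : ℂ => (1 - u) ^ (α : ℂ))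
      (Metric.ball 0 1) := by
    intro u hu
    have h := (Complex.one_add_cpow_hasFPowerSeriesOnBall_zero (a := (α : ℂ))).hasSum
      (y := -u) (by simpa [← ENNReal.ofReal_one, Metric.eball_ofReal] using hu)
    rw [zero_add, ← sub_eq_add_neg] at h
    refine Eq.trans ?_ h.tsum_eq
    refine tsum_congr fun k => ?_
    have hc : Ring.choose (α : ℂ) k = ((Ring.choose α k : ℝ) : ℂ) := by
      simpa using (Ring.map_choose Complex.ofRealHom α k).symm
    rw [binomialSeries_apply, hc, ha]
    simp [neg_pow u k]
    ring
  have hmem : v ∈ Metric.closedBall (0 : ℂ) 1 := by simpa using hv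
  have hcl := heq.of_subset_closure hcont1 hcont2 Metric.ball_subset_closedBall
    (by rw [closure_ball (0 : ℂ) one_ne_zero]) hmem
  simp only at hcl
  rw [← hcl]
  exact (summable_norm_mul_pow hsum hv).of_norm.hasSum

theorem isAbsPowerSeries_one_sub_mul_cpow {α : ℝ} (hα : 0 < α) {c : ℂ} (hc : ‖c‖ ≤ 1) :
    IsAbsPowerSeries fun u => (1 - c * u) ^ (α : ℂ) := by
  refine ⟨fun k => (((-1) ^ k * Ring.choose α k : ℝ) : ℂ) * c ^ k,
    summable_norm_mul_pow (summable_norm_choose_mul hα) hc, fun u hu => ?_⟩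
  have := hasSum_one_sub_cpow hα (v := c * u)
    (by rw [norm_mul]; exact mul_le_one₀ hc (norm_nonneg _) hu)
  simpa [mul_pow, mul_assoc] using this

/-- `R` has a continuous logarithm off its zeros in the closed unit disc, for which the power
`R^α` has an absolutely convergent power series. -/
def HasDiscPower (α : ℝ) (R : ℂ → ℂ) : Prop :=
  ∃ L S : ℂ → ℂ, ContinuousOn L {u | ‖u‖ ≤ 1 ∧ R u ≠ 0} ∧ IsAbsPowerSeries S ∧
    ∀ u, ‖u‖ ≤ 1 → R u ≠ 0 → Complex.exp (L u) = R u ∧ S u = Complex.exp (α * L u)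

/-- Principal powers are not multiplicative, whereas the powers `exp (α L)` attached to chosen
logarithms are. This is why a logarithm is carried along. -/
theorem HasDiscPower.mul {α : ℝ} {R Q : ℂ → ℂ} (hR : HasDiscPower α R) (hQ : HasDiscPower α Q) :
    HasDiscPower α fun u => R u * Q u := by
  obtain ⟨L, S, hL, hS, h⟩ := hR
  obtain ⟨L', S', hL', hS', h'⟩ := hQ
  refine ⟨fun u => L u + L' u, fun u => S u * S' u, ?_, hS.mul hS', fun u hu h0 => ?_⟩
  · exact (hL.mono fun u hu => ⟨hu.1, left_ne_zero_of_mul hu.2⟩).add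
      (hL'.mono fun u hu => ⟨hu.1, right_ne_zero_of_mul hu.2⟩)
  · obtain ⟨h1, h2⟩ := h u hu (left_ne_zero_of_mul h0)
    obtain ⟨h3, h4⟩ := h' u hu (right_ne_zero_of_mul h0)
    exact ⟨by rw [Complex.exp_add, h1, h3], by simp only [h2, h4, ← Complex.exp_add, mul_add]⟩

theorem hasDiscPower_const (α : ℝ) {c : ℂ} (hc : c ≠ 0) : HasDiscPower α fun _ => c :=
  ⟨fun _ => Complex.log c, fun _ => Complex.exp (α * Complex.log c), continuousOn_const,
    isAbsPowerSeries_const _, fun _ _ _ => ⟨Complex.exp_log hc, rfl⟩⟩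

theorem one_sub_mem_slitPlane {v : ℂ} (hv : ‖v‖ ≤ 1) (h0 : 1 - v ≠ 0) : 1 - v ∈ Complex.slitPlane := by
  rw [Complex.mem_slitPlane_iff]
  by_contra! h
  have h1 : (1 - v).re = 0 := le_antisymm h.1 (one_sub_re_nonneg hv)
  exact h0 (Complex.ext h1 h.2)

theorem hasDiscPower_one_sub_mul {α : ℝ} (hα : 0 < α) {c : ℂ} (hc : ‖c‖ ≤ 1) :
    HasDiscPower α fun u => 1 - c * u := by
  refine ⟨fun u => Complex.log (1 - c * u), fun u => (1 - c * u) ^ (α : ℂ), ?_,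
    isAbsPowerSeries_one_sub_mul_cpow hα hc, fun u _ h0 =>
      ⟨Complex.exp_log h0, by
        simp only at h0 ⊢
        rw [Complex.cpow_def_of_ne_zero h0, mul_comm]⟩⟩
  refine ContinuousOn.clog (by fun_prop) fun u hu => one_sub_mem_slitPlane ?_ hu.2
  rw [norm_mul]
  exact mul_le_one₀ hc (norm_nonneg _) hu.1

/-- Every root `ζ` has `|ζ| ≥ 1`, and `u - ζ = -ζ (1 - u/ζ)` reduces each linear factor to the
binomial series. -/
theorem hasDiscPower_eval {α : ℝ} (hα : 0 < α) {R : Polynomial ℂ} (hR0 : R ≠ 0)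
    (hR : ∀ u : ℂ, ‖u‖ < 1 → R.eval u ≠ 0) : HasDiscPower α fun u => R.eval u := by
  have hlin : ∀ ζ : ℂ, 1 ≤ ‖ζ‖ → HasDiscPower α fun u => u - ζ := by
    intro ζ hζ
    have hζ0 : ζ ≠ 0 := norm_pos_iff.mp (by linarith)
    have := (hasDiscPower_const α (neg_ne_zero.mpr hζ0)).mul
      (hasDiscPower_one_sub_mul hα (c := ζ⁻¹) (by rw [norm_inv]; exact inv_le_one_of_one_le₀ hζ))
    convert this using 2 with u
    field_simp
    ring
  have hprod : ∀ s : Multiset ℂ, (∀ ζ ∈ s, 1 ≤ ‖ζ‖) →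
      HasDiscPower α fun u => (s.map fun ζ => u - ζ).prod := by
    intro s
    induction s using Multiset.induction with
    | empty => intro _; simpa using hasDiscPower_const α one_ne_zero
    | cons ζ s ih =>
      intro h
      simp only [Multiset.map_cons, Multiset.prod_cons]
      exact (hlin ζ (h ζ (Multiset.mem_cons_self _ _))).mul
        (ih fun ξ hξ => h ξ (Multiset.mem_cons_of_mem hξ))
  have h := (hasDiscPower_const α (Polynomial.leadingCoeff_ne_zero.mpr hR0)).mul
    (hprod R.roots fun ζ hζ => by
      by_contra! hlt
      exact hR ζ hlt (Polynomial.isRoot_of_mem_roots hζ))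
  convert h using 2 with u
  conv_lhs => rw [(IsAlgClosed.splits R).eq_prod_roots]
  simp [Polynomial.eval_multiset_prod]

/-- A continuous function with values in `πℤ` is constant: otherwise `|g|` would take a value
strictly between `0` and `π`, where the sine is positive. -/
theorem continuousOn_eq_zero_of_sin_eq_zero {g : ℝ → ℝ} (hg : ContinuousOn g (Set.Icc 0 1))
    (hsin : ∀ t ∈ Set.Icc (0 : ℝ) 1, Real.sin (g t) = 0) (h1 : g 1 = 0) : g 0 = 0 := by
  by_contra h0
  have hpos := abs_pos.mpr h0
  have hpi := Real.pi_pos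
  obtain ⟨t, ht, htc⟩ := intermediate_value_Icc' zero_le_one hg.abs
    (show min |g 0| (Real.pi / 2) ∈ Set.Icc |g 1| |g 0| by
      rw [h1, abs_zero]; exact ⟨by positivity, min_le_left _ _⟩)
  simp only at htc
  have h2 : 0 < |g t| := by rw [htc]; positivity
  have h3 : |g t| < Real.pi := by rw [htc]; linarith [min_le_right |g 0| (Real.pi / 2)]
  have h4 := Real.sin_pos_of_pos_of_lt_pi h2 h3
  rcases abs_choice (g t) with h | h <;> rw [h] at h4
  · exact h4.ne' (hsin t ht)
  · rw [Real.sin_neg, hsin t ht, neg_zero] at h4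
    exact lt_irrefl _ h4

/-- If `P(u) = (1 - u) R(u)` with real `R` without zeros in the open unit disc and `R(1) = 1`, then
`P^α` has real absolutely summable coefficients, and the series represents the principal power on
the closed disc near `0` and near `1`. -/
theorem exists_summable_weights {α : ℝ} (hα : 0 < α) {P : ℂ → ℂ} {R : Polynomial ℂ}
    (hP : ∀ u, P u = (1 - u) * R.eval u) (hconj : ∀ u, P (conj u) = conj (P u))
    (hreal : ∀ t ∈ Set.Icc (0 : ℝ) 1, (R.eval (t : ℂ)).im = 0) (h1 : R.eval 1 = 1)
    (hR : ∀ u : ℂ, ‖u‖ < 1 → R.eval u ≠ 0) :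
    ∃ w : ℕ → ℝ, Summable (fun k => |w k|) ∧ ∀ c ∈ ({0, 1} : Set ℝ),
      ∀ᶠ u in 𝓝[Metric.closedBall (0 : ℂ) 1] (c : ℂ),
        HasSum (fun k => (w k : ℂ) * u ^ k) (P u ^ (α : ℂ)) := by
  have hR0 : R ≠ 0 := by rintro rfl; simp at h1
  obtain ⟨L, S, hL, hS, hLS⟩ := hasDiscPower_eval hα hR0 hR
  have hne : ∀ t ∈ Set.Icc (0 : ℝ) 1, ‖(t : ℂ)‖ ≤ 1 ∧ R.eval (t : ℂ) ≠ 0 := by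
    intro t ht
    have hn : ‖(t : ℂ)‖ = t := by simp [abs_of_nonneg ht.1]
    refine ⟨hn.le.trans ht.2, ?_⟩
    rcases ht.2.eq_or_lt with rfl | hlt
    · simp [h1]
    · exact hR _ (by rwa [hn])
  have hexpL1 : Complex.exp (L 1) = 1 := by
    have := hLS 1 (by simp) (by simp [h1])
    simp only [h1] at this
    exact this.1
  have hexp : ∀ u, ‖u‖ ≤ 1 → R.eval u ≠ 0 → Complex.exp (L u - L 1) = R.eval u := fun u hu h0 => by
    rw [Complex.exp_sub, (hLS u hu h0).1, hexpL1, div_one]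
  -- Subtracting `L 1` normalises the branch at `1`. Along `[0, 1]` the polynomial `R` is real and
  -- nonzero, so the imaginary part of the normalised logarithm is a continuous multiple of `π` and
  -- vanishes at `0` as well.
  have him : ∀ c ∈ ({0, 1} : Set ℝ), (L (c : ℂ) - L 1).im = 0 := by
    have h11 : (L ((1 : ℝ) : ℂ) - L 1).im = 0 := by simp
    rintro c (rfl | rfl)
    · refine continuousOn_eq_zero_of_sin_eq_zero (g := fun t : ℝ => (L (t : ℂ) - L 1).im) ?_ ?_ h11
      · refine Complex.continuous_im.comp_continuousOn (ContinuousOn.sub ?_ continuousOn_const)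
        exact hL.comp Complex.continuous_ofReal.continuousOn hne
      · intro t ht
        have h := congrArg Complex.im (hexp t (hne t ht).1 (hne t ht).2)
        rw [Complex.exp_im, hreal t ht] at h
        exact (mul_eq_zero.mp h).resolve_left (Real.exp_pos _).ne'
    · exact h11
  set T : ℂ → ℂ := fun u => Complex.exp (-(α * L 1)) * ((1 - 1 * u) ^ (α : ℂ) * S u) with hT
  obtain ⟨a, ha, hTa⟩ : IsAbsPowerSeries T := (isAbsPowerSeries_const _).mul
    ((isAbsPowerSeries_one_sub_mul_cpow hα (by simp)).mul hS)
  have hpi := Real.pi_pos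
  have hTP : ∀ c ∈ ({0, 1} : Set ℝ), ∀ᶠ u in 𝓝[Metric.closedBall (0 : ℂ) 1] (c : ℂ),
      T u = P u ^ (α : ℂ) ∧ (P u).arg ≠ Real.pi := by
    intro c hc
    have hcI : c ∈ Set.Icc (0 : ℝ) 1 := by rcases hc with rfl | rfl <;> simp
    have hRc : ∀ᶠ u in 𝓝[Metric.closedBall (0 : ℂ) 1] (c : ℂ), R.eval u ≠ 0 :=
      (R.continuous.continuousAt.eventually_ne (hne c hcI).2).filter_mono nhdsWithin_le_nhds
    have hLc : ∀ᶠ u in 𝓝[Metric.closedBall (0 : ℂ) 1] (c : ℂ), |(L u - L 1).im| < Real.pi / 2 := by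
      have hset : {u : ℂ | ‖u‖ ≤ 1 ∧ R.eval u ≠ 0} ∈ 𝓝[Metric.closedBall (0 : ℂ) 1] (c : ℂ) := by
        filter_upwards [hRc, self_mem_nhdsWithin] with u hu hu1
        exact ⟨by simpa using hu1, hu⟩
      have hLc := ((hL c (hne c hcI)).mono_left
        (nhdsWithin_le_of_mem hset) : Tendsto L (𝓝[Metric.closedBall (0 : ℂ) 1] (c : ℂ)) (𝓝 (L c)))
      have := (((Complex.continuous_im.tendsto _).comp (hLc.sub_const (L 1))).abs)
      rw [him c hc, abs_zero] at this
      exact this.eventually_lt_const (by positivity)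
    filter_upwards [hRc, hLc, self_mem_nhdsWithin] with u hRu hLu hu
    have hu : ‖u‖ ≤ 1 := by simpa using hu
    by_cases hu1 : 1 - u = 0
    · have : (0 : ℂ) ^ (α : ℂ) = 0 := Complex.zero_cpow (by exact_mod_cast hα.ne')
      simp [hT, hP, hu1, this, hpi.ne]
    · have harg := Complex.abs_arg_le_pi_div_two_iff.mpr (one_sub_re_nonneg hu)
      rw [abs_le] at harg
      rw [abs_lt] at hLu
      have hPe : P u = Complex.exp (Complex.log (1 - u) + (L u - L 1)) := by
        rw [Complex.exp_add, Complex.exp_log hu1, hexp u hu hRu, hP]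
      have hlog : Complex.log (P u) = Complex.log (1 - u) + (L u - L 1) := by
        -- Since `Re (1 - u) ≥ 0`, the first argument is at most `π / 2` in absolute value and the
        -- second is strictly below it; hence the sum avoids the cut.
        rw [hPe, Complex.log_exp] <;> rw [Complex.add_im, Complex.log_im] <;> linarith
      have hP0 : P u ≠ 0 := by rw [hPe]; exact Complex.exp_ne_zero _
      constructor
      · rw [Complex.cpow_def_of_ne_zero hP0, hlog, hT]
        simp only [one_mul]
        rw [Complex.cpow_def_of_ne_zero hu1, (hLS u hu hRu).2, ← Complex.exp_add, ← Complex.exp_add]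
        congr 1
        ring
      · rw [← Complex.log_im, hlog, Complex.add_im, Complex.log_im]
        linarith
  -- Off the cut `P(conj u)^α = conj (P(u)^α)`, so averaging the series with its conjugate keeps the
  -- sum and replaces the coefficients by their real parts. The condition `arg ≠ π` was recorded for
  -- this.
  refine ⟨fun k => (a k).re, ha.of_nonneg_of_le (fun _ => abs_nonneg _)
    fun k => Complex.abs_re_le_norm _, fun c hc => ?_⟩
  have hconjt : Tendsto (fun u : ℂ => conj u) (𝓝[Metric.closedBall (0 : ℂ) 1] (c : ℂ))
      (𝓝[Metric.closedBall (0 : ℂ) 1] (c : ℂ)) := by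
    refine tendsto_nhdsWithin_of_tendsto_nhds_of_eventually_within _ ?_ ?_
    · exact (Complex.continuous_conj.tendsto' _ _ (Complex.conj_ofReal c)).mono_left
        nhdsWithin_le_nhds
    · filter_upwards [self_mem_nhdsWithin] with u hu
      simpa using hu
  filter_upwards [hTP c hc, hconjt.eventually (hTP c hc), self_mem_nhdsWithin] with u h2 h3 hu
  have hu : ‖u‖ ≤ 1 := by simpa using hu
  have e1 := hTa u hu
  have e2 := hTa (conj u) (by simpa using hu)
  rw [h2.1] at e1
  rw [h3.1, hconj, Complex.conj_cpow _ _ h2.2, Complex.conj_ofReal] at e2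
  have e3 := (Complex.hasSum_conj'.mpr e2)
  have e4 := (e1.add e3).mul_left (1 / 2)
  have e5 : P u ^ (α : ℂ) = 1 / 2 * (P u ^ (α : ℂ) + conj (conj (P u ^ (α : ℂ)))) := by
    rw [Complex.conj_conj]; ring
  rw [e5]
  have hterm : ∀ k, ((a k).re : ℂ) * u ^ k =
      1 / 2 * (a k * u ^ k + conj (a k * conj u ^ k)) := ?_
  · simpa only [hterm] using e4
  intro k
  simp only [map_mul, map_pow, Complex.conj_conj]
  rw [← add_mul, Complex.add_conj]
  push_cast
  ring

end Grunwald

/-! ### Zeros of the polynomials without shift: Schur–Cohn certificates. -/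

namespace Grunwald

open ComplexConjugate

/-- At a zero of `R` the left side is `-|S|² ≤ 0`, while the right side is positive inside the disc.
-/
theorem ne_zero_of_norm_sq_sub_norm_sq {z R S : ℂ} (hz : ‖z‖ < 1) {A : ℝ} (hA : 0 < A)
    (h : R * conj R - S * conj S = (1 - z * conj z) * (A : ℂ)) : R ≠ 0 := by
  rintro rfl
  rw [Complex.mul_conj', Complex.mul_conj', Complex.mul_conj'] at h
  have h' : ‖(0 : ℂ)‖ ^ 2 - ‖S‖ ^ 2 = (1 - ‖z‖ ^ 2) * A := by exact_mod_cast h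
  have h1 : 0 < 1 - ‖z‖ ^ 2 := by nlinarith [norm_nonneg z]
  have h2 := mul_pos h1 hA
  rw [norm_zero] at h'
  nlinarith [sq_nonneg ‖S‖]

/-- Zero-stability of the backward difference formulas of order at most `6`: a Schur-Cohn
certificate for each order. -/
theorem tablePoly_zero_ne_zero {p : ℕ} (hp1 : 1 ≤ p) (hp6 : p ≤ 6) {z : ℂ} (hz : ‖z‖ < 1) :
    tablePoly p 0 z ≠ 0 := by
  have h1 : 1 - z ≠ 0 := by
    intro h
    rw [← sub_eq_zero.mp h, norm_one] at hz
    exact lt_irrefl _ hz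
  interval_cases p <;>
    simp only [tablePoly, Finset.sum_range_succ, Finset.sum_range_zero, tableCoeff] <;> push_cast
  · refine fun h0 => h1 ?_
    linear_combination h0
  -- From here on `R` is the quotient of the table polynomial by `1 - z`, cleared of denominators,
  -- and `S` is `R` with its coefficients reversed. `A` is the Hermitian form `(|R|² - |S|²) / (1 -
  -- |z|²)`, written as positively weighted squares of decreasing degree plus a positive constant.
  · have h := ne_zero_of_norm_sq_sub_norm_sq hz (R := 3 - z)
      (S := -1 + 3 * z)
      (A := 8)
      (by positivity) (by
        push_cast
        simp only [map_add, map_sub, map_neg, map_mul, map_one, map_ofNat]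
        ring)
    refine fun h0 => mul_ne_zero h1 h ?_
    linear_combination 2 * h0
  · have h := ne_zero_of_norm_sq_sub_norm_sq hz (R := 11 - 7 * z + 2 * z ^ 2)
      (S := 2 - 7 * z + 11 * z ^ 2)
      (A := 9 / 13 * ‖-7 + 13 * z‖ ^ 2 +
      1080 / 13)
      (by positivity) (by
        push_cast
        simp only [← Complex.mul_conj', map_add, map_sub, map_neg, map_mul, map_pow, map_ofNat]
        ring)
    refine fun h0 => mul_ne_zero h1 h ?_
    linear_combination 6 * h0
  · have h := ne_zero_of_norm_sq_sub_norm_sq hz (R := 25 - 23 * z + 13 * z ^ 2 - 3 * z ^ 3)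
      (S := -3 + 13 * z - 23 * z ^ 2 + 25 * z ^ 3)
      (A := 8 / 77 * ‖32 - 67 * z + 77 * z ^ 2‖ ^ 2 +
      360 / 8393 * ‖-67 + 109 * z‖ ^ 2 +
      34560 / 109)
      (by positivity) (by
        push_cast
        simp only [← Complex.mul_conj', map_add, map_sub, map_neg, map_mul, map_pow, map_ofNat]
        ring)
    refine fun h0 => mul_ne_zero h1 h ?_
    linear_combination 12 * h0
  · have h := ne_zero_of_norm_sq_sub_norm_sq hz (R := 137 - 163 * z + 137 * z ^ 2 - 63 * z ^ 3 + 12 * z ^ 4)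
      (S := 12 - 63 * z + 137 * z ^ 2 - 163 * z ^ 3 + 137 * z ^ 4)
      (A := 5 / 149 * ‖-267 + 685 * z - 863 * z ^ 2 + 745 * z ^ 3‖ ^ 2 +
      40 / 9009583 * ‖34988 - 57505 * z + 60467 * z ^ 2‖ ^ 2 +
      34200 / 1154375497 * ‖-11501 + 19091 * z‖ ^ 2 +
      131328000 / 19091)
      (by positivity) (by
        push_cast
        simp only [← Complex.mul_conj', map_add, map_sub, map_neg, map_mul, map_pow, map_ofNat]
        ring)
    refine fun h0 => mul_ne_zero h1 h ?_
    linear_combination 60 * h0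
  · have h := ne_zero_of_norm_sq_sub_norm_sq hz (R := 147 - 213 * z + 237 * z ^ 2 - 163 * z ^ 3 + 62 * z ^ 4 - 10 * z ^ 5)
      (S := -10 + 62 * z - 163 * z ^ 2 + 237 * z ^ 3 - 213 * z ^ 4 + 147 * z ^ 5)
      (A := 1 / 21509 * ‖6984 - 21591 * z + 33209 * z ^ 2 - 30691 * z ^ 3 + 21509 * z ^ 4‖ ^ 2 +
      175 / 50867042771 * ‖-1428885 + 2756347 * z - 2910521 * z ^ 2 + 2364919 * z ^ 3‖ ^ 2 +
      200 / 6972275480071 * ‖13713664 - 17112857 * z + 20637463 * z ^ 2‖ ^ 2 +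
      48600 / 1220172310621 * ‖-206179 + 413869 * z‖ ^ 2 +
      2122848000 / 413869)
      (by positivity) (by
        push_cast
        simp only [← Complex.mul_conj', map_add, map_sub, map_neg, map_mul, map_pow, map_ofNat]
        ring)
    refine fun h0 => mul_ne_zero h1 h ?_
    linear_combination 60 * h0

end Grunwald

/-! ### Fourier symbols and the error estimate for non-integral orders. -/

namespace Grunwald

open FourierTransform

theorem generator_one (α : ℝ) (u : ℂ) : generator 1 α 0 u = (1 - u) ^ (α : ℂ) := by
  unfold generator
  congr 1
  simp [tablePoly, Finset.sum_range_succ, tableCoeff]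
  ring

/-- The Fourier symbol of the weights `w` with shift `r`. -/
noncomputable def symbol (r : ℝ) (w : ℕ → ℝ) (y : ℝ) : ℂ :=
  (∑' k : ℕ, (w k : ℂ) * Complex.exp (-(y * Complex.I)) ^ k) * Complex.exp (r * (y * Complex.I))

theorem norm_exp_neg_mul_I (y : ℝ) : ‖Complex.exp (-(y * Complex.I))‖ = 1 := by
  rw [← neg_mul, ← Complex.ofReal_neg, Complex.norm_exp_ofReal_mul_I]

theorem norm_exp_ofReal_mul_mul_I (r y : ℝ) : ‖Complex.exp (r * (y * Complex.I))‖ = 1 := by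
  rw [← mul_assoc, ← Complex.ofReal_mul, Complex.norm_exp_ofReal_mul_I]

theorem summable_norm_symbol {w : ℕ → ℝ} (hw : Summable fun k => |w k|) (y : ℝ) :
    Summable fun k : ℕ => ‖(w k : ℂ) * Complex.exp (-(y * Complex.I)) ^ k‖ :=
  summable_norm_mul_pow (a := fun k => (w k : ℂ)) (by simpa using hw) (norm_exp_neg_mul_I y).le

theorem norm_symbol_le (r : ℝ) {w : ℕ → ℝ} (hw : Summable fun k => |w k|) (y : ℝ) :
    ‖symbol r w y‖ ≤ ∑' k, |w k| := by
  rw [symbol, norm_mul, norm_exp_ofReal_mul_mul_I, mul_one]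
  refine (norm_tsum_le_tsum_norm (summable_norm_symbol hw y)).trans_eq ?_
  simp only [norm_mul, norm_pow, norm_exp_neg_mul_I, one_pow, mul_one, Complex.norm_real,
    Real.norm_eq_abs]

theorem continuous_symbol (r : ℝ) {w : ℕ → ℝ} (hw : Summable fun k => |w k|) :
    Continuous (symbol r w) := by
  unfold symbol
  refine Continuous.mul (continuous_tsum (fun k => by fun_prop) hw fun k y => ?_) (by fun_prop)
  simp only [norm_mul, norm_pow, norm_exp_neg_mul_I, one_pow, mul_one, Complex.norm_real,
    Real.norm_eq_abs, le_refl]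

theorem norm_ofReal_mul_I_cpow (y α : ℝ) : ‖((y : ℂ) * Complex.I) ^ (α : ℂ)‖ = |y| ^ α := by
  rw [Complex.norm_cpow_real, norm_mul, Complex.norm_I, mul_one, Complex.norm_real,
    Real.norm_eq_abs]

/-- On the imaginary axis the symbol of a generator of order `p` differs from `z^α` by a multiple
of `|z|^(α + p)`. -/
theorem exists_norm_symbol_sub_le {α : ℝ} (hα : 0 < α) (r : ℝ) {p : ℕ} (hp1 : 1 ≤ p) (hp6 : p ≤ 6)
    {w : ℕ → ℝ} (hw : Summable fun k => |w k|)
    (hgen : ∀ᶠ u in 𝓝[Metric.closedBall (0 : ℂ) 1] 1,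
      HasSum (fun k => (w k : ℂ) * u ^ k) (generator p α r u)) :
    ∃ C, ∀ y : ℝ, ‖symbol r w y - ((y : ℂ) * Complex.I) ^ (α : ℂ)‖ ≤ C * |y| ^ (α + p) := by
  have hexp : Tendsto (fun y : ℝ => Complex.exp (-(y * Complex.I))) (𝓝 0)
      (𝓝[Metric.closedBall (0 : ℂ) 1] 1) := by
    refine tendsto_nhdsWithin_of_tendsto_nhds_of_eventually_within _ ?_ ?_
    · have : Continuous fun y : ℝ => Complex.exp (-(y * Complex.I)) := by fun_prop
      exact this.tendsto' 0 _ (by simp)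
    · exact Eventually.of_forall fun y => by simp [norm_exp_neg_mul_I]
  have h1 := hexp.eventually hgen
  obtain ⟨C, hC⟩ := (generator_isBigO α r hα hp1 hp6).bound
  have h2 : ∀ᶠ y : ℝ in 𝓝 0, y ≠ 0 → ‖1 / ((y : ℂ) * Complex.I) ^ (α : ℂ) *
      generator p α r (Complex.exp (-(y * Complex.I))) * Complex.exp ((r : ℂ) * (y * Complex.I)) -
        1‖ ≤ C * ‖((y : ℂ) * Complex.I) ^ p‖ := by
    have hc : Continuous fun y : ℝ => (y : ℂ) * Complex.I := by fun_prop
    exact (hc.tendsto' 0 0 (by simp)).eventually (eventually_nhdsWithin_iff.mp hC) |>.mono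
      fun y hy h0 => hy (by simpa using h0)
  obtain ⟨δ, hδ, hball⟩ := Metric.eventually_nhds_iff.mp (h1.and h2)
  set B := ∑' k, |w k| with hB
  have hB0 : 0 ≤ B := tsum_nonneg fun _ => abs_nonneg _
  set s := α + (p : ℝ) with hs
  have hs0 : 0 < s := by positivity
  -- `C` serves for `|y| < δ`, by the order condition. For `|y| ≥ δ` the symbol is at most `B` and
  -- the power equals `|y|^α` in norm; multiplying by powers of `|y| / δ ≥ 1` gives the second
  -- constant.
  refine ⟨max C (B / δ ^ s + 1 / δ ^ (p : ℝ)), fun y => ?_⟩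
  have hys : 0 ≤ |y| ^ s := by positivity
  rcases lt_or_ge |y| δ with hlt | hge
  · refine le_trans ?_ (mul_le_mul_of_nonneg_right (le_max_left _ _) hys)
    obtain ⟨h3, h4⟩ := hball (y := y) (by simpa using hlt)
    rcases eq_or_ne y 0 with rfl | hy
    · have e : generator p α r 1 = 0 := by
        rw [generator, tablePoly_one _ hp1 hp6, Complex.zero_cpow (by exact_mod_cast hα.ne')]
      have h5 := h3.tsum_eq
      simp only [Complex.ofReal_zero, zero_mul, neg_zero, Complex.exp_zero] at h5
      rw [e] at h5
      simp only [symbol, Complex.ofReal_zero, zero_mul, neg_zero, Complex.exp_zero, h5]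
      simp [Complex.zero_cpow (show (α : ℂ) ≠ 0 by exact_mod_cast hα.ne'), hs0.ne',
        Real.zero_rpow]
    · have h5 := h4 hy
      have hz : ((y : ℂ) * Complex.I) ^ (α : ℂ) ≠ 0 := by
        simp [Complex.cpow_eq_zero_iff, hy]
      have e : symbol r w y - ((y : ℂ) * Complex.I) ^ (α : ℂ) =
          ((y : ℂ) * Complex.I) ^ (α : ℂ) * (1 / ((y : ℂ) * Complex.I) ^ (α : ℂ) *
            generator p α r (Complex.exp (-(y * Complex.I))) *
            Complex.exp ((r : ℂ) * (y * Complex.I)) - 1) := by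
        rw [symbol, h3.tsum_eq]
        field_simp
      rw [e, norm_mul, norm_ofReal_mul_I_cpow]
      calc _ ≤ |y| ^ α * (C * ‖((y : ℂ) * Complex.I) ^ p‖) := by gcongr
        _ = C * |y| ^ s := by
          rw [norm_pow, norm_mul, Complex.norm_I, mul_one, Complex.norm_real, Real.norm_eq_abs,
            hs, Real.rpow_add (abs_pos.mpr hy), Real.rpow_natCast]
          ring
  · refine le_trans ?_ (mul_le_mul_of_nonneg_right (le_max_right _ _) hys)
    have hy : 0 < |y| := hδ.trans_le hge
    calc _ ≤ ‖symbol r w y‖ + ‖((y : ℂ) * Complex.I) ^ (α : ℂ)‖ := norm_sub_le _ _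
      _ ≤ B * 1 + |y| ^ α * 1 := by
        rw [norm_ofReal_mul_I_cpow, mul_one, mul_one]
        gcongr
        exact norm_symbol_le r hw y
      _ ≤ B * (|y| / δ) ^ s + |y| ^ α * (|y| / δ) ^ (p : ℝ) := by
        have : 1 ≤ |y| / δ := (one_le_div hδ).mpr hge
        gcongr
        · exact Real.one_le_rpow this hs0.le
        · exact Real.one_le_rpow this (by positivity)
      _ = _ := by
        rw [Real.div_rpow hy.le hδ.le, Real.div_rpow hy.le hδ.le, hs, Real.rpow_add hy]
        ring

theorem ofReal_mul_cpow {h : ℝ} (hh : 0 < h) (z : ℂ) {a : ℂ} (ha : a ≠ 0) :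
    ((h : ℂ) * z) ^ a = (h : ℂ) ^ a * z ^ a := by
  rcases eq_or_ne z 0 with rfl | hz
  · simp [Complex.zero_cpow ha]
  · have hh' : (h : ℂ) ≠ 0 := by exact_mod_cast hh.ne'
    rw [Complex.cpow_def_of_ne_zero (mul_ne_zero hh' hz), Complex.cpow_def_of_ne_zero hh',
      Complex.cpow_def_of_ne_zero hz, Complex.log_ofReal_mul hh hz, Complex.ofReal_log hh.le,
      add_mul, Complex.exp_add]

theorem integrable_rpow_mul_of_decay {g : ℝ → ℂ} (hg : Continuous g) {K N s : ℝ}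
    (hK : ∀ t, ‖g t‖ ≤ K * (1 + ‖t‖) ^ (-N)) (hs : 0 ≤ s) (hsN : s + 1 < N) :
    Integrable fun t : ℝ => |t| ^ s * ‖g t‖ := by
  have hK0 : 0 ≤ K := by
    have := (norm_nonneg _).trans (hK 0)
    simpa using this
  have h1 : Integrable fun t : ℝ => (1 + ‖t‖) ^ (-(N - s)) :=
    integrable_one_add_norm (by simpa using by linarith)
  refine (h1.const_mul K).mono' ?_ (Eventually.of_forall fun t => ?_)
  · have : Continuous fun t : ℝ => |t| ^ s := continuous_abs.rpow_const fun _ => Or.inr hs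
    exact (this.mul hg.norm).aestronglyMeasurable
  · have hpos : 0 < 1 + ‖t‖ := by positivity
    rw [Real.norm_of_nonneg (by positivity), show -(N - s) = s + -N by ring, Real.rpow_add hpos]
    calc |t| ^ s * ‖g t‖ ≤ (1 + ‖t‖) ^ s * (K * (1 + ‖t‖) ^ (-N)) := by
          gcongr
          · rw [Real.norm_eq_abs]; linarith
          · exact hK t
      _ = _ := by ring

theorem continuous_ofReal_mul_I_cpow {α : ℝ} (hα : 0 < α) :
    Continuous fun t : ℝ => ((2 * Real.pi * t : ℝ) * Complex.I : ℂ) ^ (α : ℂ) := by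
  refine continuous_iff_continuousAt.mpr fun t => ?_
  have h := Complex.continuousAt_cpow_const_of_re_pos (z := (2 * Real.pi * t : ℝ) * Complex.I)
    (w := α) (Or.inl (by simp)) (by simpa using hα)
  exact ContinuousAt.comp (f := fun t : ℝ => ((2 * Real.pi * t : ℝ) * Complex.I : ℂ)) h
    (by fun_prop)

/-- The derivative of order `α` of a function with Fourier transform `g`. -/
noncomputable def fourierDeriv (α : ℝ) (g : ℝ → ℂ) (x : ℝ) : ℂ :=
  ∫ t : ℝ, Complex.exp ((2 * Real.pi * t * x : ℝ) * Complex.I) *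
    (((2 * Real.pi * t : ℝ) * Complex.I) ^ (α : ℂ) * g t)

theorem summable_mul_of_bounded {w : ℕ → ℝ} (hw : Summable fun k => |w k|) {f : ℝ → ℝ} {M : ℝ}
    (hf : ∀ x, |f x| ≤ M) (a : ℕ → ℝ) : Summable fun k => w k * f (a k) := by
  refine Summable.of_norm_bounded (hw.mul_right M) fun k => ?_
  rw [norm_mul]
  exact mul_le_mul_of_nonneg_left (hf _) (norm_nonneg _)

/-- Translations act on the transform by exponentials, so the weighted sum becomes multiplication by
the symbol at `2πth`. Summability of `|w k|` and integrability of `g` justify exchanging sum and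
integral. -/
theorem leftOp_eq_integral (α r : ℝ) {w : ℕ → ℝ} (hw : Summable fun k => |w k|) {f : ℝ → ℝ}
    {g : ℝ → ℂ} (hg : Integrable g)
    (hf : ∀ x, (f x : ℂ) = ∫ t : ℝ, Complex.exp ((2 * Real.pi * t * x : ℝ) * Complex.I) * g t)
    {h : ℝ} (hh : 0 < h) (x : ℝ) :
    (leftOp α r w f h x : ℂ) = ∫ t : ℝ, Complex.exp ((2 * Real.pi * t * x : ℝ) * Complex.I) *
      (1 / (h : ℂ) ^ (α : ℂ) * symbol r w (2 * Real.pi * t * h) * g t) := by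
  set F : ℕ → ℝ → ℂ := fun k t => (w k : ℂ) *
    (Complex.exp ((2 * Real.pi * t * (x - (k - r) * h) : ℝ) * Complex.I) * g t) with hF
  have hFn : ∀ k t, ‖F k t‖ = |w k| * ‖g t‖ := fun k t => by
    simp only [hF, norm_mul, Complex.norm_exp_ofReal_mul_I, one_mul, Complex.norm_real,
      Real.norm_eq_abs]
  have hFi : ∀ k, Integrable (F k) := fun k => by
    refine Integrable.const_mul ?_ _
    refine hg.bdd_mul (c := 1) (Continuous.aestronglyMeasurable (by fun_prop))
      (Eventually.of_forall fun t => ?_)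
    rw [Complex.norm_exp_ofReal_mul_I]
  have hsum := hasSum_integral_of_summable_integral_norm (F := F) hFi (by
    simp only [hFn, integral_const_mul]
    exact hw.mul_right _)
  have hFint : ∀ k, ∫ t, F k t = ((w k * f (x - (k - r) * h) : ℝ) : ℂ) := fun k => by
    rw [hF, integral_const_mul, ← hf]; push_cast; rfl
  simp only [hFint] at hsum
  have hts := hsum.tsum_eq
  rw [← Complex.ofReal_tsum] at hts
  rw [leftOp, Complex.ofReal_mul, hts, ← integral_const_mul]
  refine integral_congr_ae (Eventually.of_forall fun t => ?_)
  have hterm : ∀ k, F k t = (w k : ℂ) * Complex.exp (-((2 * Real.pi * t * h : ℝ) * Complex.I)) ^ k *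
      (Complex.exp (r * ((2 * Real.pi * t * h : ℝ) * Complex.I)) *
        (Complex.exp ((2 * Real.pi * t * x : ℝ) * Complex.I) * g t)) := fun k => by
    rw [hF, mul_assoc, ← Complex.exp_nat_mul, ← mul_assoc (Complex.exp (r * _)),
      ← mul_assoc (Complex.exp (k * _)), ← Complex.exp_add, ← Complex.exp_add]
    simp only
    congr 3
    push_cast
    ring
  simp only [hterm, tsum_mul_right, symbol]
  rw [Complex.ofReal_div, Complex.ofReal_one, Complex.ofReal_cpow hh.le]
  ring

/-- The error of a Grünwald type operator on a function whose Fourier transform decays. -/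
theorem exists_leftOp_sub_fourierDeriv_le {α : ℝ} (hα : 0 < α) (r : ℝ) {q : ℕ} {w : ℕ → ℝ}
    (hw : Summable fun k => |w k|) {C : ℝ}
    (hC : ∀ y : ℝ, ‖symbol r w y - ((y : ℂ) * Complex.I) ^ (α : ℂ)‖ ≤ C * |y| ^ (α + q))
    {f : ℝ → ℝ} {g : ℝ → ℂ} (hgc : Continuous g) {K N : ℝ}
    (hK : ∀ t, ‖g t‖ ≤ K * (1 + ‖t‖) ^ (-N)) (hN : α + q + 1 < N)
    (hf : ∀ x, (f x : ℂ) = ∫ t : ℝ, Complex.exp ((2 * Real.pi * t * x : ℝ) * Complex.I) * g t) :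
    ∃ C', ∀ h > 0, ∀ x, |leftOp α r w f h x - (fourierDeriv α g x).re| ≤ C' * h ^ q := by
  have hq : (0 : ℝ) ≤ q := q.cast_nonneg
  have hg : Integrable g := by
    have := integrable_rpow_mul_of_decay hgc hK le_rfl (by linarith)
    simp only [Real.rpow_zero, one_mul] at this
    exact (integrable_norm_iff hgc.aestronglyMeasurable).mp this
  have hga := integrable_rpow_mul_of_decay hgc hK hα.le (by linarith)
  have hgs := integrable_rpow_mul_of_decay hgc hK (s := α + q) (by positivity) hN
  refine ⟨C * (2 * Real.pi) ^ (α + q) * ∫ t, |t| ^ (α + q) * ‖g t‖, fun h hh x => ?_⟩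
  have hha : (h : ℂ) ^ (α : ℂ) ≠ 0 := by
    simp [Complex.cpow_eq_zero_iff, hh.ne']
  have hE : Continuous fun t : ℝ => Complex.exp ((2 * Real.pi * t * x : ℝ) * Complex.I) := by
    fun_prop
  have hi1 : Integrable fun t : ℝ => Complex.exp ((2 * Real.pi * t * x : ℝ) * Complex.I) *
      (1 / (h : ℂ) ^ (α : ℂ) * symbol r w (2 * Real.pi * t * h) * g t) := by
    refine Integrable.mono' (hg.norm.const_mul (‖1 / (h : ℂ) ^ (α : ℂ)‖ * ∑' k, |w k|)) ?_
      (Eventually.of_forall fun t => ?_)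
    · have := (continuous_symbol r hw).comp (show Continuous fun t : ℝ => 2 * Real.pi * t * h by
        fun_prop)
      exact (hE.mul ((continuous_const.mul this).mul hgc)).aestronglyMeasurable
    · rw [norm_mul, norm_mul, norm_mul, Complex.norm_exp_ofReal_mul_I, one_mul]
      gcongr
      exact norm_symbol_le r hw _
  have hi2 : Integrable fun t : ℝ => Complex.exp ((2 * Real.pi * t * x : ℝ) * Complex.I) *
      (((2 * Real.pi * t : ℝ) * Complex.I) ^ (α : ℂ) * g t) := by
    refine Integrable.mono' (hga.const_mul ((2 * Real.pi) ^ α)) ?_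
      (Eventually.of_forall fun t => ?_)
    · exact (hE.mul ((continuous_ofReal_mul_I_cpow hα).mul hgc)).aestronglyMeasurable
    · rw [norm_mul, norm_mul, Complex.norm_exp_ofReal_mul_I, one_mul, norm_ofReal_mul_I_cpow,
        abs_mul, abs_of_pos Real.two_pi_pos, Real.mul_rpow (by positivity) (abs_nonneg _), mul_assoc]
  have hbound : ‖(leftOp α r w f h x : ℂ) - fourierDeriv α g x‖ ≤
      ∫ t, C * (2 * Real.pi) ^ (α + q) * h ^ q * (|t| ^ (α + q) * ‖g t‖) := by
    rw [leftOp_eq_integral α r hw hg hf hh x, fourierDeriv, ← integral_sub hi1 hi2]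
    refine norm_integral_le_of_norm_le (hgs.const_mul _) (Eventually.of_forall fun t => ?_)
    -- Homogeneity for `h > 0` rewrites both multipliers at the point `y = 2πth`. The bound
    -- `|y|^(α+q)` then cancels the factor `h^(-α)` and leaves `h^q`.
    have hpow : (((2 * Real.pi * t * h : ℝ) : ℂ) * Complex.I) ^ (α : ℂ) =
        (h : ℂ) ^ (α : ℂ) * ((2 * Real.pi * t : ℝ) * Complex.I) ^ (α : ℂ) := by
      rw [← ofReal_mul_cpow hh _ (show (α : ℂ) ≠ 0 by exact_mod_cast hα.ne')]
      congr 1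
      push_cast
      ring
    have e : Complex.exp ((2 * Real.pi * t * x : ℝ) * Complex.I) *
          (1 / (h : ℂ) ^ (α : ℂ) * symbol r w (2 * Real.pi * t * h) * g t) -
        Complex.exp ((2 * Real.pi * t * x : ℝ) * Complex.I) *
          (((2 * Real.pi * t : ℝ) * Complex.I) ^ (α : ℂ) * g t) =
        Complex.exp ((2 * Real.pi * t * x : ℝ) * Complex.I) * (1 / (h : ℂ) ^ (α : ℂ)) *
          ((symbol r w (2 * Real.pi * t * h) -
            ((2 * Real.pi * t * h : ℝ) * Complex.I) ^ (α : ℂ)) * g t) := by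
      rw [hpow]
      field_simp
    rw [e, norm_mul, norm_mul, norm_mul, Complex.norm_exp_ofReal_mul_I, one_mul, norm_div, norm_one,
      Complex.norm_cpow_real, Complex.norm_real, Real.norm_of_nonneg hh.le]
    calc _ ≤ 1 / h ^ α * (C * |2 * Real.pi * t * h| ^ (α + q) * ‖g t‖) := by
          gcongr
          exact hC _
      _ = _ := by
        rw [abs_mul, abs_mul, abs_of_pos Real.two_pi_pos, abs_of_pos hh,
          Real.mul_rpow (by positivity) hh.le, Real.mul_rpow (by positivity) (abs_nonneg _),
          Real.rpow_add hh, Real.rpow_natCast]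
        have : h ^ α ≠ 0 := (Real.rpow_pos_of_pos hh α).ne'
        field_simp
  have hre : |leftOp α r w f h x - (fourierDeriv α g x).re| ≤
      ‖(leftOp α r w f h x : ℂ) - fourierDeriv α g x‖ := by
    simpa using Complex.abs_re_le_norm ((leftOp α r w f h x : ℂ) - fourierDeriv α g x)
  refine (hre.trans hbound).trans_eq ?_
  rw [integral_const_mul]
  ring

theorem iteratedDeriv_ofReal_comp {f : ℝ → ℝ} {n k : ℕ} (hf : ContDiff ℝ n f) (hk : k ≤ n) :
    iteratedDeriv k (fun x => (f x : ℂ)) = fun x => ((iteratedDeriv k f x : ℝ) : ℂ) := by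
  funext x
  have h := Complex.ofRealCLM.iteratedFDeriv_comp_left (x := x) hf.contDiffAt
    (i := k) (by exact_mod_cast hk)
  rw [iteratedDeriv_eq_iteratedFDeriv, iteratedDeriv_eq_iteratedFDeriv]
  exact congrArg (fun T => T fun _ => (1 : ℝ)) h

/-- Fourier representation of a function with integrable derivatives. -/
theorem SmoothIntegrable.exists_fourier {α : ℝ} {p : ℕ} (hp1 : 1 ≤ p) {f : ℝ → ℝ}
    (hf : SmoothIntegrable α p f) :
    ∃ g : ℝ → ℂ, Continuous g ∧
      (∃ K, ∀ t, ‖g t‖ ≤ K * (1 + ‖t‖) ^ (-((p + ⌈α⌉₊ + 1 : ℕ) : ℝ))) ∧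
      ∀ x, (f x : ℂ) = ∫ t : ℝ, Complex.exp ((2 * Real.pi * t * x : ℝ) * Complex.I) * g t := by
  obtain ⟨hcd, hint⟩ := hf
  set N := p + ⌈α⌉₊ + 1 with hN
  set F : ℝ → ℂ := fun x => (f x : ℂ) with hF
  have hFcd : ContDiff ℝ N F := Complex.ofRealCLM.contDiff.comp hcd
  have hFint : ∀ k ≤ N, Integrable (iteratedDeriv k F) := fun k hk => by
    rw [hF, iteratedDeriv_ofReal_comp hcd hk]
    exact (hint k hk).ofReal
  have hF0 : Integrable F := by simpa using hFint 0 (Nat.zero_le _)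
  have hnorm : ∀ (G : ℝ → ℂ) (t : ℝ), ‖𝓕 G t‖ ≤ ∫ x, ‖G x‖ := fun G t =>
    VectorFourier.norm_fourierIntegral_le_integral_norm _ _ _ _ _
  have hgc : Continuous (𝓕 F) := VectorFourier.fourierIntegral_continuous Real.continuous_fourierChar
    (by fun_prop) hF0
  have hdecay : ∃ K, ∀ t, ‖𝓕 F t‖ ≤ K * (1 + ‖t‖) ^ (-(N : ℝ)) := by
    -- The factor comes from `(1 + |t|)^N ≤ 2^(N-1) (1 + |t|^N)`; the two integrals bound the
    -- transforms of `F` and of its `N`-th derivative.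
    refine ⟨2 ^ (N - 1) * ((∫ x, ‖F x‖) + ∫ x, ‖iteratedDeriv N F x‖), fun t => ?_⟩
    have hpos : 0 < 1 + ‖t‖ := by positivity
    rw [Real.rpow_neg hpos.le, Real.rpow_natCast, ← div_eq_mul_inv, le_div_iff₀ (by positivity)]
    have h1 := hnorm F t
    have h2 := hnorm (iteratedDeriv N F) t
    rw [Real.fourier_iteratedDeriv (N := N) (by exact_mod_cast hFcd)
      (fun k hk => hFint k (by exact_mod_cast hk)) le_rfl] at h2
    have h3 : ‖t‖ ^ N * ‖𝓕 F t‖ ≤ ∫ x, ‖iteratedDeriv N F x‖ := by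
      refine le_trans ?_ h2
      rw [norm_smul, norm_pow]
      gcongr
      simp only [norm_mul, Complex.norm_I, Complex.norm_real, Complex.norm_ofNat, mul_one]
      have : 1 ≤ 2 * ‖Real.pi‖ := by
        rw [Real.norm_of_nonneg Real.pi_pos.le]; linarith [Real.two_le_pi]
      exact le_mul_of_one_le_left (norm_nonneg _) this
    calc ‖𝓕 F t‖ * (1 + ‖t‖) ^ N ≤ ‖𝓕 F t‖ * (2 ^ (N - 1) * (1 ^ N + ‖t‖ ^ N)) := by
          gcongr
          exact add_pow_le zero_le_one (norm_nonneg t) N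
      _ = 2 ^ (N - 1) * (‖𝓕 F t‖ + ‖t‖ ^ N * ‖𝓕 F t‖) := by ring
      _ ≤ _ := by gcongr
  refine ⟨𝓕 F, hgc, hdecay, fun x => ?_⟩
  obtain ⟨K, hK⟩ := hdecay
  have hg : Integrable (𝓕 F) := by
    have hN2 : (0 : ℝ) + 1 < N := by
      have : 1 < N := by omega
      rw [zero_add]; exact_mod_cast this
    have := integrable_rpow_mul_of_decay hgc hK le_rfl hN2
    simp only [Real.rpow_zero, one_mul] at this
    exact (integrable_norm_iff hgc.aestronglyMeasurable).mp this
  have h := congrFun (hFcd.continuous.fourierInv_fourier_eq hF0 hg) x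
  rw [Real.fourierInv_eq'] at h
  rw [show (f x : ℂ) = F x from rfl, ← h]
  refine integral_congr_ae (Eventually.of_forall fun t => ?_)
  simp only [smul_eq_mul]
  congr 4
  simp
  ring

end Grunwald

/-! ### Integral orders by Taylor expansion, and assembly of the cases. -/

namespace Grunwald

open ComplexConjugate

theorem exists_abs_le_of_integrable_deriv {g : ℝ → ℝ} (hg : ContDiff ℝ 1 g)
    (hint : Integrable (deriv g)) : ∃ M, ∀ x, |g x| ≤ M := by
  refine ⟨|g 0| + ∫ t, |deriv g t|, fun x => ?_⟩
  have hd := intervalIntegral.integral_deriv_eq_sub (f := g) (a := 0) (b := x)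
    (fun y _ => (hg.differentiable one_ne_zero) y) hint.intervalIntegrable
  have h1 : |g x - g 0| ≤ ∫ t, |deriv g t| := by
    rw [← hd, ← Real.norm_eq_abs]
    refine intervalIntegral.norm_integral_le_integral_norm_uIoc.trans ?_
    exact setIntegral_le_integral hint.norm (Eventually.of_forall fun t => norm_nonneg _)
  have h2 := abs_add_le (g 0) (g x - g 0)
  rw [add_sub_cancel] at h2
  linarith

theorem abs_sub_taylor_le {f : ℝ → ℝ} {m : ℕ} (hf : ContDiff ℝ (m + 1 : ℕ) f) {M : ℝ}
    (hM : ∀ x, |iteratedDeriv (m + 1) f x| ≤ M) (x t : ℝ) :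
    |f (x + t) - ∑ j ∈ Finset.range (m + 1), t ^ j / j.factorial * iteratedDeriv j f x| ≤
      M * |t| ^ (m + 1) := by
  have hM0 : 0 ≤ M := (abs_nonneg _).trans (hM x)
  rcases eq_or_ne t 0 with rfl | ht
  · rw [Finset.sum_range_succ']
    simp
  · have hx : x ≠ x + t := by simpa using ht
    obtain ⟨y, -, hy⟩ := taylor_mean_remainder_lagrange_iteratedDeriv (n := m) hx
      (by exact_mod_cast hf.contDiffOn)
    have hT : taylorWithinEval f m (Set.uIcc x (x + t)) x (x + t) =
        ∑ j ∈ Finset.range (m + 1), t ^ j / j.factorial * iteratedDeriv j f x := by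
      rw [taylor_within_apply]
      refine Finset.sum_congr rfl fun j hj => ?_
      rw [iteratedDerivWithin_eq_iteratedDeriv (uniqueDiffOn_uIcc hx)
        ((hf.of_le (by exact_mod_cast (Finset.mem_range.mp hj).le)).contDiffAt) Set.left_mem_uIcc,
        add_sub_cancel_left, smul_eq_mul]
      ring
    rw [← hT, hy, add_sub_cancel_left, abs_div, abs_mul, abs_pow]
    have hfac : (1 : ℝ) ≤ |((m + 1).factorial : ℝ)| := by
      rw [Nat.abs_cast]; exact_mod_cast Nat.one_le_iff_ne_zero.mpr (Nat.factorial_ne_zero _)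
    refine (div_le_self (by positivity) hfac).trans ?_
    gcongr
    exact hM y

/-- The limit at `0` isolates the constant coefficient; dividing by `z` lowers the degree and the
order together. -/
theorem eq_zero_of_sum_isBigO {N : ℕ} {c : ℕ → ℂ}
    (h : (fun z : ℂ => ∑ j ∈ Finset.range N, c j * z ^ j) =O[𝓝[≠] 0] fun z => z ^ N) :
    ∀ j < N, c j = 0 := by
  induction N generalizing c with
  | zero => intro j hj; omega
  | succ N ih =>
    have h0 : c 0 = 0 := by
      have ht : Tendsto (fun z : ℂ => z ^ (N + 1)) (𝓝[≠] 0) (𝓝 0) := by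
        have : Continuous fun z : ℂ => z ^ (N + 1) := by fun_prop
        exact (this.tendsto' 0 _ (by simp)).mono_left nhdsWithin_le_nhds
      have h1 := h.trans_tendsto ht
      have h2 : Tendsto (fun z : ℂ => ∑ j ∈ Finset.range (N + 1), c j * z ^ j) (𝓝[≠] 0)
          (𝓝 (c 0)) := by
        have : Continuous fun z : ℂ => ∑ j ∈ Finset.range (N + 1), c j * z ^ j := by fun_prop
        refine (this.tendsto' 0 _ ?_).mono_left nhdsWithin_le_nhds
        rw [Finset.sum_range_succ']
        simp
      exact tendsto_nhds_unique h2 h1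
    have h1 : (fun z : ℂ => ∑ j ∈ Finset.range N, c (j + 1) * z ^ j) =O[𝓝[≠] 0]
        fun z => z ^ N := by
      refine ((isBigO_refl (fun z : ℂ => z⁻¹) (𝓝[≠] 0)).mul h).congr' ?_ ?_
      · filter_upwards [self_mem_nhdsWithin] with z hz
        have hz : z ≠ 0 := hz
        rw [Finset.sum_range_succ', h0, zero_mul, add_zero, Finset.mul_sum]
        refine Finset.sum_congr rfl fun j _ => ?_
        rw [pow_succ]
        field_simp
      · filter_upwards [self_mem_nhdsWithin] with z hz
        have hz : z ≠ 0 := hz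
        rw [pow_succ]
        field_simp
    intro j hj
    rcases j with _ | j
    · exact h0
    · exact ih h1 j (by omega)

/-- Comparing Taylor coefficients below degree `n + p` turns the order condition into moment
equations for the weights. -/
theorem sum_moment_eq {s : Finset ℕ} {w : ℕ → ℝ} {r : ℝ} {n p : ℕ} (hp : 1 ≤ p)
    (hord : (fun z : ℂ => ∑ k ∈ s, (w k : ℂ) * Complex.exp (((r - k : ℝ) : ℂ) * z) - z ^ n)
      =O[𝓝[≠] 0] fun z => z ^ (n + p)) {j : ℕ} (hj : j < n + p) :
    ∑ k ∈ s, w k * ((r - k) ^ j / j.factorial) = if j = n then 1 else 0 := by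
  have h1 : (fun z : ℂ => ∑ k ∈ s, (w k : ℂ) * (Complex.exp (((r - k : ℝ) : ℂ) * z) -
      ∑ m ∈ Finset.range (n + p), (((r - k : ℝ) : ℂ) * z) ^ m / (m.factorial : ℂ)))
      =O[𝓝[≠] 0] fun z => z ^ (n + p) :=
    IsBigO.fun_sum fun k _ =>
      ((exp_sub_sum_isBigO ((r - k : ℝ) : ℂ) (n + p)).mono nhdsWithin_le_nhds).const_mul_left _
  have h2 := eq_zero_of_sum_isBigO (N := n + p)
    (c := fun j => ((∑ k ∈ s, w k * ((r - k) ^ j / j.factorial) : ℝ) : ℂ) -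
      if j = n then 1 else 0) ((hord.sub h1).congr_left fun z => ?_) j hj
  · have h3 := sub_eq_zero.mp h2
    split_ifs at h3 ⊢ <;> exact_mod_cast h3
  · simp only [mul_sub, sub_mul, Finset.sum_sub_distrib, ite_mul, one_mul, zero_mul]
    rw [Finset.sum_ite_eq' _ n, if_pos (Finset.mem_range.mpr (by omega))]
    simp only [Finset.mul_sum]
    rw [Finset.sum_comm]
    push_cast
    simp only [Finset.sum_mul]
    have : ∀ m ∈ Finset.range (n + p), ∑ k ∈ s, (w k : ℂ) * ((((r : ℂ) - k) * z) ^ m /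
        (m.factorial : ℂ)) = ∑ k ∈ s, (w k : ℂ) * (((r : ℂ) - k) ^ m / (m.factorial : ℂ)) * z ^ m :=
      fun m _ => Finset.sum_congr rfl fun k _ => by rw [mul_pow]; ring
    rw [Finset.sum_congr rfl this]
    ring

/-- The error of a finite difference operator for a derivative of integral order. -/
theorem exists_leftOp_sub_iteratedDeriv_le {s : Finset ℕ} {w : ℕ → ℝ} (hw : ∀ k ∉ s, w k = 0)
    {r : ℝ} {n p : ℕ} (hp : 1 ≤ p)
    (hord : (fun z : ℂ => ∑ k ∈ s, (w k : ℂ) * Complex.exp (((r - k : ℝ) : ℂ) * z) - z ^ n)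
      =O[𝓝[≠] 0] fun z => z ^ (n + p))
    {f : ℝ → ℝ} (hf : ContDiff ℝ (n + p : ℕ) f) {M : ℝ}
    (hM : ∀ x, |iteratedDeriv (n + p) f x| ≤ M) :
    ∃ C, ∀ h > 0, ∀ x, |leftOp n r w f h x - iteratedDeriv n f x| ≤ C * h ^ p := by
  obtain ⟨m, hm⟩ : ∃ m, n + p = m + 1 := ⟨n + p - 1, by omega⟩
  refine ⟨∑ k ∈ s, |w k| * (M * |r - k| ^ (n + p)), fun h hh x => ?_⟩
  have hhn : h ^ n ≠ 0 := pow_ne_zero _ hh.ne'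
  -- The moment equations annihilate every Taylor term except `j = n`.
  have htay : ∑ k ∈ s, w k * ∑ j ∈ Finset.range (n + p),
      ((r - k) * h) ^ j / j.factorial * iteratedDeriv j f x = h ^ n * iteratedDeriv n f x := by
    simp only [Finset.mul_sum]
    rw [Finset.sum_comm]
    have : ∀ j ∈ Finset.range (n + p), ∑ k ∈ s, w k *
        (((r - k) * h) ^ j / j.factorial * iteratedDeriv j f x) =
        if j = n then h ^ j * iteratedDeriv j f x else 0 := fun j hj => by
      have h1 := sum_moment_eq hp hord (Finset.mem_range.mp hj)
      rw [← one_mul (h ^ j * _), ← zero_mul (h ^ j * iteratedDeriv j f x), ← ite_mul, ← h1,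
        Finset.sum_mul]
      refine Finset.sum_congr rfl fun k _ => ?_
      rw [mul_pow]
      ring
    rw [Finset.sum_congr rfl this, Finset.sum_ite_eq' _ n,
      if_pos (Finset.mem_range.mpr (by omega))]
  have e : leftOp n r w f h x - iteratedDeriv n f x = 1 / h ^ n * ∑ k ∈ s, w k *
      (f (x + (r - k) * h) - ∑ j ∈ Finset.range (n + p),
        ((r - k) * h) ^ j / j.factorial * iteratedDeriv j f x) := by
    simp only [mul_sub, Finset.sum_sub_distrib]
    rw [htay, leftOp, tsum_eq_sum (s := s) fun k hk => by rw [hw k hk, zero_mul], Real.rpow_natCast]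
    have : ∀ k : ℕ, x - ((k : ℝ) - r) * h = x + (r - k) * h := fun k => by ring
    have hcancel : 1 / h ^ n * (h ^ n * iteratedDeriv n f x) = iteratedDeriv n f x := by field_simp
    simp only [this]
    linear_combination hcancel
  rw [e, abs_mul, abs_of_pos (by positivity : 0 < 1 / h ^ n)]
  calc _ ≤ 1 / h ^ n * ∑ k ∈ s, |w k| * (M * |(r - k) * h| ^ (n + p)) := by
        gcongr
        refine (Finset.abs_sum_le_sum_abs _ _).trans (Finset.sum_le_sum fun k _ => ?_)
        rw [abs_mul]
        gcongr
        have := abs_sub_taylor_le (m := m) (by rwa [← hm]) (by rwa [← hm]) x ((r - k) * h)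
        rwa [← hm] at this
    _ = _ := by
      rw [Finset.mul_sum, Finset.sum_mul]
      refine Finset.sum_congr rfl fun k _ => ?_
      rw [abs_mul, abs_of_pos hh, mul_pow, pow_add h]
      field_simp

/-- The left half of `ApproximatesWithOrder`. -/
def LeftApproximates (α r : ℝ) (p : ℕ) (w : ℕ → ℝ) (f : ℝ → ℝ) : Prop :=
  ∃ D : ℝ → ℝ, (∀ x, HasLeftGLDerivAt α f (D x) x) ∧
    (∀ h > 0, ∀ x, Summable fun k : ℕ => w k * f (x - ((k : ℝ) - r) * h)) ∧
    ∃ C : ℝ, ∀ᶠ h in 𝓝[>] (0 : ℝ), ∀ x, |leftOp α r w f h x - D x| ≤ C * h ^ p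

/-- The Grünwald–Letnikov quotient is the unshifted operator with the binomial weights, so a
first-order error bound against the same `D` identifies `D` as the derivative. -/
theorem leftApproximates_of_le {α r : ℝ} {p : ℕ} {w : ℕ → ℝ} {f D : ℝ → ℝ} {C C' : ℝ}
    (hs : ∀ h > 0, ∀ x, Summable fun k : ℕ => w k * f (x - ((k : ℝ) - r) * h))
    (hC : ∀ h > 0, ∀ x, |leftOp α r w f h x - D x| ≤ C * h ^ p)
    (hs' : ∀ h > 0, ∀ x, Summable fun k : ℕ =>
      (-1 : ℝ) ^ k * Ring.choose α k * f (x - ((k : ℝ) - 0) * h))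
    (hC' : ∀ h > 0, ∀ x,
      |leftOp α 0 (fun k => (-1 : ℝ) ^ k * Ring.choose α k) f h x - D x| ≤ C' * h ^ 1) :
    LeftApproximates α r p w f := by
  refine ⟨D, fun x => ⟨?_, ?_⟩, hs, C, ?_⟩
  · filter_upwards [self_mem_nhdsWithin] with h hh
    simpa using hs' h hh x
  · rw [tendsto_iff_norm_sub_tendsto_zero]
    have hlim : Tendsto (fun h : ℝ => C' * h ^ 1) (𝓝[>] 0) (𝓝 0) := by
      have : Continuous fun h : ℝ => C' * h ^ 1 := by fun_prop
      exact (this.tendsto' 0 _ (by simp)).mono_left nhdsWithin_le_nhds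
    refine squeeze_zero' (Eventually.of_forall fun _ => norm_nonneg _) ?_ hlim
    filter_upwards [self_mem_nhdsWithin] with h hh
    simpa [leftOp, leftGLQuotient] using hC' h hh x
  · filter_upwards [self_mem_nhdsWithin] with h hh x using hC h hh x

theorem SmoothIntegrable.comp_neg {α : ℝ} {p : ℕ} {f : ℝ → ℝ} (hf : SmoothIntegrable α p f) :
    SmoothIntegrable α p fun x => f (-x) := by
  refine ⟨hf.1.comp contDiff_neg, fun k hk => ?_⟩
  have : iteratedDeriv k (fun x => f (-x)) = fun x => (-1 : ℝ) ^ k • iteratedDeriv k f (-x) :=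
    funext fun x => iteratedDeriv_comp_neg k f x
  rw [this]
  exact (hf.2 k hk).comp_neg.smul ((-1 : ℝ) ^ k)

/-- The reflection `x ↦ -x` exchanges left and right and preserves the class of functions. -/
theorem approximatesWithOrder_of_left {α r : ℝ} {p : ℕ} {w : ℕ → ℝ}
    (h : ∀ f, SmoothIntegrable α p f → LeftApproximates α r p w f) {f : ℝ → ℝ}
    (hf : SmoothIntegrable α p f) : ApproximatesWithOrder α r p w f := by
  refine ⟨h f hf, ?_⟩
  obtain ⟨D, hD, hs, C, hC⟩ := h _ hf.comp_neg
  have e0 : ∀ (k h x : ℝ), -(-x - k * h) = x + k * h := fun k h x => by ring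
  refine ⟨fun x => D (-x), fun x => ⟨?_, ?_⟩, fun h hh x => ?_, C, ?_⟩
  · simpa only [e0] using (hD (-x)).1
  · have := (hD (-x)).2
    unfold leftGLQuotient at this
    simpa only [e0] using! this
  · simpa only [e0] using hs h hh (-x)
  · filter_upwards [hC] with h hh x
    have := hh (-x)
    unfold leftOp at this
    simpa only [e0] using! this

theorem sum_exp_sub_pow_isBigO {n p : ℕ} (hn : 1 ≤ n) (hp1 : 1 ≤ p) (hp6 : p ≤ 6) (r : ℝ)
    {s : Finset ℕ} {w : ℕ → ℝ} (hgen : ∀ u, ∑ k ∈ s, (w k : ℂ) * u ^ k = generator p n r u) :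
    (fun z : ℂ => ∑ k ∈ s, (w k : ℂ) * Complex.exp (((r - k : ℝ) : ℂ) * z) - z ^ n)
      =O[𝓝[≠] 0] fun z => z ^ (n + p) := by
  have h := (isBigO_refl (fun z : ℂ => z ^ n) (𝓝[≠] 0)).mul
    (generator_isBigO n r (by exact_mod_cast hn) hp1 hp6)
  refine h.congr' ?_ (Eventually.of_forall fun z => by simp only [pow_add])
  filter_upwards [self_mem_nhdsWithin] with z hz
  have hz : z ≠ 0 := hz
  have e : ∑ k ∈ s, (w k : ℂ) * Complex.exp (((r - k : ℝ) : ℂ) * z) =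
      generator p n r (Complex.exp (-z)) * Complex.exp (r * z) := by
    rw [← hgen, Finset.sum_mul]
    refine Finset.sum_congr rfl fun k _ => ?_
    rw [mul_assoc, ← Complex.exp_nat_mul, ← Complex.exp_add]
    congr 2
    push_cast
    ring
  rw [e, Complex.ofReal_natCast, Complex.cpow_natCast]
  field_simp

theorem summable_mul_of_finite_support {s : Finset ℕ} {w : ℕ → ℝ} (hw : ∀ k ∉ s, w k = 0)
    (a : ℕ → ℝ) : Summable fun k => w k * a k :=
  summable_of_ne_finset_zero (s := s) fun k hk => by rw [hw k hk, zero_mul]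

theorem leftApproximates_natCast {n p : ℕ} (hn : 1 ≤ n) (hp1 : 1 ≤ p) (hp6 : p ≤ 6) (r : ℝ)
    {s : Finset ℕ} {w : ℕ → ℝ} (hw : ∀ k ∉ s, w k = 0)
    (hgen : ∀ u, ∑ k ∈ s, (w k : ℂ) * u ^ k = generator p n r u) {f : ℝ → ℝ}
    (hf : SmoothIntegrable n p f) : LeftApproximates n r p w f := by
  obtain ⟨hcd, hint⟩ := hf
  rw [Nat.ceil_natCast] at hcd hint
  -- A derivative of order `n + q` is bounded because the next one is integrable; for `q = p` this
  -- uses the last order `p + n + 1`.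
  have hb : ∀ q ≤ p, ∃ M, ∀ x, |iteratedDeriv (n + q) f x| ≤ M := fun q hq => by
    refine exists_abs_le_of_integrable_deriv ?_ ?_
    · rw [iteratedDeriv_eq_iterate]
      exact ContDiff.iterate_deriv' 1 (n + q)
        (hcd.of_le (by exact_mod_cast (by omega : 1 + (n + q) ≤ p + n + 1)))
    · rw [← iteratedDeriv_succ]
      exact hint _ (by omega)
  obtain ⟨M, hM⟩ := hb p le_rfl
  obtain ⟨M', hM'⟩ := hb 1 hp1
  have hgl : ∀ k ∉ Finset.range (n + 1), (-1 : ℝ) ^ k * Ring.choose (n : ℝ) k = 0 := fun k hk => by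
    rw [Ring.choose_natCast, Nat.choose_eq_zero_of_lt (by simpa using hk), Nat.cast_zero, mul_zero]
  have hglgen : ∀ u : ℂ, ∑ k ∈ Finset.range (n + 1),
      (((-1 : ℝ) ^ k * Ring.choose (n : ℝ) k : ℝ) : ℂ) * u ^ k = generator 1 n 0 u := fun u => by
    rw [generator_one, Complex.ofReal_natCast, Complex.cpow_natCast, sub_eq_neg_add, add_pow]
    refine Finset.sum_congr rfl fun k _ => ?_
    rw [Ring.choose_natCast, neg_pow u]
    push_cast
    ring
  obtain ⟨C, hC⟩ := exists_leftOp_sub_iteratedDeriv_le hw hp1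
    (sum_exp_sub_pow_isBigO hn hp1 hp6 r hgen)
    (hcd.of_le (by exact_mod_cast (by omega : n + p ≤ p + n + 1))) hM
  obtain ⟨C', hC'⟩ := exists_leftOp_sub_iteratedDeriv_le hgl le_rfl
    (sum_exp_sub_pow_isBigO hn le_rfl (by norm_num) 0 hglgen)
    (hcd.of_le (by exact_mod_cast (by omega : n + 1 ≤ p + n + 1))) hM'
  exact leftApproximates_of_le (fun h _ x => summable_mul_of_finite_support hw _) hC
    (fun h _ x => summable_mul_of_finite_support hgl _) hC'

theorem leftApproximates_of_summable {α : ℝ} (hα : 0 < α) (hαn : ∀ n : ℕ, α ≠ n) (r : ℝ) {p : ℕ}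
    (hp1 : 1 ≤ p) (hp6 : p ≤ 6) {w : ℕ → ℝ} (hw : Summable fun k => |w k|)
    (hgen : ∀ᶠ u in 𝓝[Metric.closedBall (0 : ℂ) 1] 1,
      HasSum (fun k => (w k : ℂ) * u ^ k) (generator p α r u)) {f : ℝ → ℝ}
    (hf : SmoothIntegrable α p f) : LeftApproximates α r p w f := by
  -- Strictness is essential: the decay exponent `p + ⌈α⌉ + 1` must exceed `α + p + 1` for the error
  -- integral to converge.
  have hlt : α < ⌈α⌉₊ := (Nat.le_ceil α).lt_of_ne (hαn _)
  obtain ⟨g, hgc, ⟨K, hK⟩, hfg⟩ := hf.exists_fourier hp1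
  have hN : α + p + 1 < ((p + ⌈α⌉₊ + 1 : ℕ) : ℝ) := by push_cast; linarith
  have hp1' : (1 : ℝ) ≤ p := by exact_mod_cast hp1
  have hbd : ∀ x, |f x| ≤ ∫ t, ‖g t‖ := fun x => by
    rw [← Real.norm_eq_abs, ← Complex.norm_real, hfg]
    refine (norm_integral_le_integral_norm _).trans_eq ?_
    simp only [norm_mul, Complex.norm_exp_ofReal_mul_I, one_mul]
  have hgl : Summable fun k : ℕ => |(-1 : ℝ) ^ k * Ring.choose α k| := by
    simpa [abs_mul] using summable_abs_choose hα
  have hglgen : ∀ᶠ u in 𝓝[Metric.closedBall (0 : ℂ) 1] 1,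
      HasSum (fun k => (((-1 : ℝ) ^ k * Ring.choose α k : ℝ) : ℂ) * u ^ k)
        (generator 1 α 0 u) := by
    filter_upwards [self_mem_nhdsWithin] with u hu
    rw [generator_one]
    exact hasSum_one_sub_cpow hα (by simpa using hu)
  obtain ⟨B, hB⟩ := exists_norm_symbol_sub_le hα r hp1 hp6 hw hgen
  obtain ⟨B', hB'⟩ := exists_norm_symbol_sub_le hα 0 le_rfl (by norm_num) hgl hglgen
  obtain ⟨C, hC⟩ := exists_leftOp_sub_fourierDeriv_le hα r hw hB hgc hK hN hfg
  obtain ⟨C', hC'⟩ := exists_leftOp_sub_fourierDeriv_le hα 0 hgl hB' hgc hK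
    (by push_cast at hN ⊢; linarith) hfg
  exact leftApproximates_of_le (fun h _ x => summable_mul_of_bounded hw hbd _) hC
    (fun h _ x => summable_mul_of_bounded hgl hbd _) hC'

/-- The table polynomial divided by its zero `1`. -/
theorem exists_tablePoly_eq_one_sub_mul (ρ : ℝ) {p : ℕ} (hp1 : 1 ≤ p) (hp6 : p ≤ 6) :
    ∃ R : Polynomial ℂ, (∀ u, tablePoly p ρ u = (1 - u) * R.eval u) ∧ R.eval 1 = 1 := by
  set P : Polynomial ℂ := ∑ k ∈ Finset.range (p + 1),
    Polynomial.C (tableCoeff ρ p k : ℂ) * Polynomial.X ^ k with hP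
  have hPe : ∀ u, P.eval u = tablePoly p ρ u := fun u => by
    simp [hP, tablePoly, Polynomial.eval_finsetSum]
  obtain ⟨Q, hQ⟩ := Polynomial.dvd_iff_isRoot.mpr
    (show P.IsRoot 1 by rw [Polynomial.IsRoot, hPe, tablePoly_one ρ hp1 hp6])
  refine ⟨-Q, fun u => ?_, ?_⟩
  · rw [← hPe, hQ]
    simp
    ring
  -- Differentiating the factorisation at `1` gives `R(1) = -P'(1) = 1`.
  · have h1 := P.hasDerivAt 1
    rw [show (fun x => P.eval x) = tablePoly p ρ from funext hPe] at h1
    have h2 := h1.unique (hasStrictDerivAt_tablePoly_one ρ hp1 hp6).hasDerivAt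
    rw [hQ] at h2
    simp at h2
    simp [h2]

theorem exists_weights_of_ne_zero {α : ℝ} (hα : 0 < α) (r : ℝ) {p : ℕ} (hp1 : 1 ≤ p) (hp6 : p ≤ 6)
    (h0 : ∀ z : ℂ, ‖z‖ < 1 → tablePoly p (r / α) z ≠ 0) :
    ∃ w : ℕ → ℝ, Summable (fun k => |w k|) ∧ IsGeneratingFunction (generator p α r) w ∧
      ∀ᶠ u in 𝓝[Metric.closedBall (0 : ℂ) 1] 1,
        HasSum (fun k => (w k : ℂ) * u ^ k) (generator p α r u) := by
  obtain ⟨R, hR, hR1⟩ := exists_tablePoly_eq_one_sub_mul (r / α) hp1 hp6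
  have hreal : ∀ t ∈ Set.Icc (0 : ℝ) 1, (R.eval (t : ℂ)).im = 0 := by
    intro t ht
    rcases ht.2.eq_or_lt with rfl | hlt
    · simp [hR1]
    · have h1 : (1 : ℂ) - t ≠ 0 := by
        rw [sub_ne_zero]; exact_mod_cast hlt.ne'
      have h2 := tablePoly_conj p (r / α) t
      rw [Complex.conj_ofReal, hR, map_mul, map_sub, map_one, Complex.conj_ofReal] at h2
      exact Complex.conj_eq_iff_im.mp (mul_left_cancel₀ h1 h2).symm
  obtain ⟨w, hw, hgen⟩ := exists_summable_weights hα hR (tablePoly_conj p (r / α)) hreal hR1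
    fun u hu hRu => h0 u hu (by rw [hR, hRu, mul_zero])
  refine ⟨w, hw, ?_, ?_⟩
  · have := hgen 0 (by simp)
    rwa [Complex.ofReal_zero, nhdsWithin_eq_nhds.mpr (Metric.closedBall_mem_nhds _ one_pos)] at this
  · have := hgen 1 (by simp)
    rwa [Complex.ofReal_one] at this

theorem exists_weights_natCast (n p : ℕ) (r : ℝ) :
    ∃ (w : ℕ → ℝ) (s : Finset ℕ), (∀ k ∉ s, w k = 0) ∧
      ∀ u, ∑ k ∈ s, (w k : ℂ) * u ^ k = generator p n r u := by
  set P : Polynomial ℝ := ∑ k ∈ Finset.range (p + 1),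
    Polynomial.C (tableCoeff (r / n) p k) * Polynomial.X ^ k with hP
  refine ⟨(P ^ n).coeff, (P ^ n).support, fun k hk => Polynomial.notMem_support_iff.mp hk,
    fun u => ?_⟩
  have h1 : (P ^ n).aeval u = ∑ k ∈ (P ^ n).support, ((P ^ n).coeff k : ℂ) * u ^ k := by
    rw [Polynomial.aeval_def, Polynomial.eval₂_eq_sum, Polynomial.sum]
    rfl
  rw [← h1, map_pow, generator, Complex.ofReal_natCast, Complex.cpow_natCast]
  congr 1
  simp [hP, tablePoly]

end Grunwald

theorem mainTheorem2 (p : ℕ) (hp1 : 1 ≤ p) (hp6 : p ≤ 6) (α r : ℝ) (hα : 0 < α) :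
    -- the order condition `G_r(z) = z^{-α} W(e^{-z}) e^{rz} = 1 + O(z^p)`
    ((fun z : ℂ =>
        1 / z ^ (α : ℂ) * Grunwald.generator p α r (Complex.exp (-z)) * Complex.exp ((r : ℂ) * z)
          - 1) =O[𝓝[≠] 0] fun z : ℂ => z ^ p) ∧
    -- approximation of the fractional derivatives with order `p` and shift `r`
    ((r = 0 ∨ (∃ n : ℕ, α = n) ∨
        ∀ z : ℂ, ‖z‖ < 1 → Grunwald.tablePoly p (r / α) z ≠ 0) →
      ∃ w : ℕ → ℝ, Grunwald.IsGeneratingFunction (Grunwald.generator p α r) w ∧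
        ∀ f : ℝ → ℝ, Grunwald.SmoothIntegrable α p f →
          Grunwald.ApproximatesWithOrder α r p w f) ∧
    -- without shift these are Lubich's generators
    (∀ z : ℂ, Grunwald.generator p α 0 z = Grunwald.lubich p α z) := by
  refine ⟨Grunwald.generator_isBigO α r hα hp1 hp6, fun hcases => ?_,
    Grunwald.generator_zero_shift α hp1 hp6⟩
  -- Integral orders are separated first, whichever hypothesis holds: the Fourier estimate needs
  -- `⌈α⌉ > α`, and the polynomial case needs no condition on zeros.
  by_cases hint : ∃ n : ℕ, α = n
  · obtain ⟨n, rfl⟩ := hint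
    have hn : 1 ≤ n := by exact_mod_cast hα
    obtain ⟨w, s, hw, hgen⟩ := Grunwald.exists_weights_natCast n p r
    refine ⟨w, Eventually.of_forall fun u => ?_, fun f hf =>
      Grunwald.approximatesWithOrder_of_left
        (fun f hf => Grunwald.leftApproximates_natCast hn hp1 hp6 r hw hgen hf) hf⟩
    rw [← hgen u]
    exact hasSum_sum_of_ne_finset_zero fun k hk => by simp [hw k hk]
  · have h0 : ∀ z : ℂ, ‖z‖ < 1 → Grunwald.tablePoly p (r / α) z ≠ 0 := by
      rcases hcases with rfl | h | h
      · rw [zero_div]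
        exact fun z hz => Grunwald.tablePoly_zero_ne_zero hp1 hp6 hz
      · exact absurd h hint
      · exact h
    obtain ⟨w, hw, hgen0, hgen1⟩ := Grunwald.exists_weights_of_ne_zero hα r hp1 hp6 h0
    exact ⟨w, hgen0, fun f hf => Grunwald.approximatesWithOrder_of_left
      (fun f hf => Grunwald.leftApproximates_of_summable hα (not_exists.mp hint) r hp1 hp6 hw
        hgen1 hf) hf⟩
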